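/- For a tree $T$ on $n\ge 2$ vertices let $\lambda_1(T)\ge\lambda_2(T)\ge\cdots\ge\lambda_n(T)$ be its adjacency eigenvalues, counted with multiplicity, and for real $\alpha$ put $\Psi(T,\alpha)=\alpha\lambda_1(T)+(1-\alpha)\lambda_2(T)$. For integers $k_1,k_2\ge 0$ and $\ell\ge 1$, let $DC(k_1,k_2,\ell)$ denote the tree on $k_1+k_2+\ell$ vertices obtained by attaching $k_1$ and $k_2$ leaves, respectively, to the two terminal vertices of a path on $\ell$ vertices. Theorem. Let $0<\alpha\le\frac12$. There is an integer $N$, depending only on $\alpha$, such that for every $n\ge N$ the following hold, where uniqueness is up to isomorphism. (i) If $n$ is odd, then $DC\left(\frac{n-3}{2},\frac{n-3}{2},3\right)$ is the unique maximizer of $\Psi(\cdot,\alpha)$ among all trees on $n$ vertices. (ii) If $n$ is even, then every maximizer of $\Psi(\cdot,\alpha)$ among all trees on $n$ vertices is isomorphic to $DC\left(\frac{n-4}{2},\frac{n-4}{2},4\right)$ or to $DC\left(\frac{n-4}{2},\frac{n-2}{2},3\right)$. Moreover, if $\alpha<\frac{\sqrt5-1}{2\sqrt5}$, then $DC\left(\frac{n-4}{2},\frac{n-4}{2},4\right)$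 is the unique maximizer, and if $\alpha>\frac{\sqrt5-1}{2\sqrt5}$, then $DC\left(\frac{n-4}{2},\frac{n-2}{2},3\right)$ is the unique maximizer. -/

import Mathlib

/-- The `k`-th largest adjacency eigenvalue `λ_k(G)` of a finite graph, counted with multiplicity:
`λ_1(G) ≥ λ_2(G) ≥ ⋯ ≥ λ_n(G)` with `n` the number of vertices.
(Value `0` when `k` is not between `1` and `n`.) -/
noncomputable def adjEigenvalue {V : Type*} [Fintype V] (G : SimpleGraph V) (k : ℕ) : ℝ := by
  classical
  exact if h : 1 ≤ k ∧ k ≤ Fintype.card V then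
    (G.isHermitian_adjMatrix ℝ).eigenvalues₀ ⟨k - 1, by omega⟩ else 0

/-- `Ψ(G, α) = α λ_1(G) + (1 - α) λ_2(G)`. -/
noncomputable def Psi {V : Type*} [Fintype V] (G : SimpleGraph V) (α : ℝ) : ℝ :=
  α * adjEigenvalue G 1 + (1 - α) * adjEigenvalue G 2

/-- `T` is a tree on `n` vertices which attains the maximum of `Ψ(·, α)` over all `n`-vertex
trees. -/
def IsPsiMaximizer {n : ℕ} (T : SimpleGraph (Fin n)) (α : ℝ) : Prop :=
  T.IsTree ∧ ∀ T' : SimpleGraph (Fin n), T'.IsTree → Psi T' α ≤ Psi T α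

/-- The vertices of a double comet: `k₁` leaves at the first end of the path, the `ℓ` vertices of
the path, and `k₂` leaves at the last end of the path. -/
inductive DCVertex (k₁ k₂ ℓ : ℕ) : Type
  | leafL (i : Fin k₁) : DCVertex k₁ k₂ ℓ
  | path (i : Fin ℓ) : DCVertex k₁ k₂ ℓ
  | leafR (i : Fin k₂) : DCVertex k₁ k₂ ℓ

/-- One orientation of the edges of a double comet: consecutive path vertices, left leaves with
the first path vertex, right leaves with the last path vertex. -/
def DCVertex.Rel {k₁ k₂ ℓ : ℕ} : DCVertex k₁ k₂ ℓ → DCVertex k₁ k₂ ℓ → Prop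
  | .path i, .path j => (i : ℕ) + 1 = (j : ℕ)
  | .leafL _, .path j => (j : ℕ) = 0
  | .leafR _, .path j => (j : ℕ) + 1 = ℓ
  | _, _ => False

/-- The double comet `DC(k₁, k₂, ℓ)`: the tree obtained from a path on `ℓ` vertices by attaching
`k₁` and `k₂` leaves to its two terminal vertices. -/
def DC (k₁ k₂ ℓ : ℕ) : SimpleGraph (DCVertex k₁ k₂ ℓ) :=
  SimpleGraph.fromRel DCVertex.Rel

/-!
The proof compares every tree `T` on `n` vertices with a double comet through three facts.

* The spectrum of a tree is symmetric and the squares of its eigenvalues add up to `2 (n - 1)`, so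
  `λ₁² + λ₂² ≤ n - 1` (`SimpleGraph.IsTree.sq_adjEigenvalue_add_sq_le`). As `α ≤ 1 / 2`, the value
  `α λ₁ + (1 - α) λ₂` under this constraint decreases when `λ₂` does (`convexComb_lt`). Both
  `DC(k, k, 3)` and `DC(k, k + 1, 3)` attain `λ₁² + λ₂² = n - 1`, so they strictly beat all trees
  with a smaller second eigenvalue.
* By interlacing, `λ₂(T) ≤ λ₁(T - v)` for every vertex `v`. If `v` is a centroid, then the components
  of `T - v` have at most `n / 2` vertices, and a tree with `m` edges has `λ₁² ≤ m`.
* A tree with `m` edges for which `λ₁²` is close to `m` is a star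
  (`SimpleGraph.IsTree.exists_isStarAt`).

For odd `n = 2 k + 3` the second fact gives `λ₂² ≤ k = λ₂(DC(k, k, 3))²`. In the case of equality
the eigenvector vanishes at the centroid and is supported on two star components; the value of `λ₁`
forces both to be attached at their centres (`SimpleGraph.IsTree.nonempty_iso_DC_of_odd`).

For even `n = 2 k + 4`, a tree whose `λ₂` is at least that of `DC(k, k + 1, 3)` consists of two stars
on `n / 2` vertices joined by an edge, and comparing `λ₂` leaves `DC(k, k, 4)` and `DC(k, k + 1, 3)`
only (`SimpleGraph.IsTree.nonempty_iso_DC_of_even`). Between these two, the expansion of `Ψ` to the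
order `1 / √k` decides: `λ₁` and `λ₂` are both `√(k + 1) + o(1 / √k)` for `DC(k, k, 4)`, while
`λ² = k + 1 + (1 ± √5) / 2` for `DC(k, k + 1, 3)`.
-/

/-! ### The adjacency operator and the two largest eigenvalues -/

open Classical in
/-- The adjacency operator of `G`: the sum of `z` over the neighbours of `v`. -/
noncomputable def nbrSum {V : Type*} [Fintype V] (G : SimpleGraph V) (z : V → ℝ) (v : V) : ℝ :=
  ∑ w with G.Adj v w, z w

section Spectral

variable {V W : Type*} [Fintype V] [Fintype W] {G : SimpleGraph V}

open Classical in
lemma nbrSum_eq_sum_ite (G : SimpleGraph V) (z : V → ℝ) (v : V) :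
    nbrSum G z v = ∑ w, if G.Adj v w then z w else 0 :=
  Finset.sum_filter _ _

lemma nbrSum_add (G : SimpleGraph V) (y z : V → ℝ) :
    nbrSum G (y + z) = nbrSum G y + nbrSum G z := by
  ext v
  simp [nbrSum, Finset.sum_add_distrib]

lemma nbrSum_smul (G : SimpleGraph V) (a : ℝ) (z : V → ℝ) :
    nbrSum G (a • z) = a • nbrSum G z := by
  ext v
  simp [nbrSum, Finset.mul_sum]

lemma dotProduct_nbrSum_comm (G : SimpleGraph V) (y z : V → ℝ) :
    y ⬝ᵥ nbrSum G z = nbrSum G y ⬝ᵥ z := by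
  classical
  simp only [dotProduct, nbrSum_eq_sum_ite, Finset.mul_sum, Finset.sum_mul]
  rw [Finset.sum_comm]
  refine Finset.sum_congr rfl fun v _ => Finset.sum_congr rfl fun w _ => ?_
  by_cases h : G.Adj v w
  · simp [h, h.symm]
  · have h' : ¬G.Adj w v := fun h' => h h'.symm
    simp [h, h']

/-- Isomorphisms intertwine the adjacency operators. -/
lemma nbrSum_comp_iso {H : SimpleGraph W} (φ : G ≃g H) (z : W → ℝ) (v : V) :
    nbrSum G (z ∘ φ) v = nbrSum H z (φ v) := by
  classical
  rw [nbrSum_eq_sum_ite, nbrSum_eq_sum_ite]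
  refine Fintype.sum_equiv φ.toEquiv _ _ fun w => ?_
  have h : H.Adj (φ v) (φ w) ↔ G.Adj v w := φ.map_adj_iff
  exact if_congr h.symm rfl rfl

lemma dotProduct_comp_equiv (φ : V ≃ W) (y z : W → ℝ) : (y ∘ φ) ⬝ᵥ (z ∘ φ) = y ⬝ᵥ z :=
  Fintype.sum_equiv φ _ _ fun _ => rfl

/-- Orthonormal eigenvectors for the two largest eigenvalues, with the variational bounds which
make them the two largest. -/
theorem exists_top_eigenvectors (G : SimpleGraph V) (hV : 2 ≤ Fintype.card V) :
    ∃ f₁ f₂ : V → ℝ, f₁ ⬝ᵥ f₁ = 1 ∧ f₂ ⬝ᵥ f₂ = 1 ∧ f₁ ⬝ᵥ f₂ = 0 ∧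
      nbrSum G f₁ = adjEigenvalue G 1 • f₁ ∧ nbrSum G f₂ = adjEigenvalue G 2 • f₂ ∧
      adjEigenvalue G 2 ≤ adjEigenvalue G 1 ∧
      (∀ z : V → ℝ, z ⬝ᵥ nbrSum G z ≤ adjEigenvalue G 1 * (z ⬝ᵥ z)) ∧
      ∀ z : V → ℝ, f₁ ⬝ᵥ z = 0 → z ⬝ᵥ nbrSum G z ≤ adjEigenvalue G 2 * (z ⬝ᵥ z) := by
  classical
  set hA := G.isHermitian_adjMatrix ℝ with hA_def
  set e : Fin (Fintype.card V) ≃ V := Fintype.equivOfCardEq (Fintype.card_fin _) with he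
  set b := hA.eigenvectorBasis with hb
  have h1 : adjEigenvalue G 1 = hA.eigenvalues₀ ⟨0, by omega⟩ := by
    simp only [adjEigenvalue]
    rw [dif_pos ⟨le_rfl, by omega⟩]
  have h2 : adjEigenvalue G 2 = hA.eigenvalues₀ ⟨1, by omega⟩ := by
    simp only [adjEigenvalue]
    rw [dif_pos ⟨by norm_num, hV⟩]
  have hnbr : ∀ z : V → ℝ, nbrSum G z = (G.adjMatrix ℝ).mulVec z := by
    intro z
    ext v
    rw [SimpleGraph.adjMatrix_mulVec_apply, nbrSum]
    refine Finset.sum_congr ?_ fun _ _ => rfl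
    ext w
    simp
  have hinner : ∀ x y : EuclideanSpace ℝ V, inner ℝ x y = (x : V → ℝ) ⬝ᵥ (y : V → ℝ) := by
    intro x y
    simp [PiLp.inner_apply, dotProduct, mul_comm]
  have heig : ∀ i, nbrSum G (b (e i) : V → ℝ) = hA.eigenvalues₀ i • (b (e i) : V → ℝ) := by
    intro i
    rw [hnbr, hA.mulVec_eigenvectorBasis]
    simp [Matrix.IsHermitian.eigenvalues, he, hb]
  have horth : ∀ i j, (b (e i) : V → ℝ) ⬝ᵥ (b (e j) : V → ℝ) = if i = j then 1 else 0 := by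
    intro i j
    rw [← hinner, orthonormal_iff_ite.mp b.orthonormal]
    simp
  have hexp : ∀ x y : V → ℝ,
      ∑ i, (x ⬝ᵥ (b (e i) : V → ℝ)) * ((b (e i) : V → ℝ) ⬝ᵥ y) = x ⬝ᵥ y := by
    intro x y
    have := b.sum_inner_mul_inner (WithLp.toLp 2 x) (WithLp.toLp 2 y)
    simp only [hinner] at this
    rw [← this]
    exact Fintype.sum_equiv e _ _ fun _ => rfl
  have hquad : ∀ z : V → ℝ, z ⬝ᵥ nbrSum G z =
      ∑ i, hA.eigenvalues₀ i * ((b (e i) : V → ℝ) ⬝ᵥ z) ^ 2 := by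
    intro z
    rw [← hexp]
    refine Finset.sum_congr rfl fun i _ => ?_
    rw [dotProduct_nbrSum_comm, heig, smul_dotProduct, dotProduct_comm z, smul_eq_mul]
    ring
  have hnorm : ∀ z : V → ℝ, z ⬝ᵥ z = ∑ i, ((b (e i) : V → ℝ) ⬝ᵥ z) ^ 2 := by
    intro z
    rw [← hexp]
    refine Finset.sum_congr rfl fun i _ => ?_
    rw [dotProduct_comm z]
    ring
  have hanti := hA.eigenvalues₀_antitone
  refine ⟨b (e ⟨0, by omega⟩), b (e ⟨1, by omega⟩), by simp [horth], by simp [horth],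
    by simp [horth], by rw [h1]; exact heig _, by rw [h2]; exact heig _, ?_, ?_, ?_⟩
  · rw [h1, h2]
    exact hanti (by simp [Fin.le_def])
  · intro z
    rw [hquad, hnorm, Finset.mul_sum, h1]
    gcongr with i
    exact hanti (by simp [Fin.le_def])
  · intro z hz
    rw [hquad, hnorm, Finset.mul_sum, h2]
    refine Finset.sum_le_sum fun i _ => ?_
    by_cases hi : i.1 = 0
    · have : i = ⟨0, by omega⟩ := Fin.ext hi
      rw [this, hz]
      simp
    · exact mul_le_mul_of_nonneg_right (hanti (by rw [Fin.le_def]; simp only; omega))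
        (sq_nonneg _)

lemma dotProduct_self_pos {z : V → ℝ} (hz : z ≠ 0) : 0 < z ⬝ᵥ z := by
  refine lt_of_le_of_ne (Finset.sum_nonneg fun i _ => mul_self_nonneg _) fun h => hz ?_
  exact dotProduct_self_eq_zero.mp h.symm

/-- An upper bound for `λ₁` from a positive vector `f` with `A f ≤ t f`. -/
lemma adjEigenvalue_one_le_of_supersolution (hV : 2 ≤ Fintype.card V) {f : V → ℝ} {t : ℝ}
    (hf : ∀ v, 0 < f v) (h : ∀ v, nbrSum G f v ≤ t * f v) : adjEigenvalue G 1 ≤ t := by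
  classical
  obtain ⟨f₁, -, h₁, -, -, he, -⟩ := exists_top_eigenvectors G hV
  have : Nonempty V := Fintype.card_pos_iff.mp (by omega)
  obtain ⟨v, hv⟩ := Finite.exists_max fun v => |f₁ v| / f v
  set M := |f₁ v| / f v with hM
  have hle : ∀ w, |f₁ w| ≤ M * f w := fun w => (div_le_iff₀ (hf w)).mp (hv w)
  have hMv : |f₁ v| = M * f v := by rw [hM]; field_simp [(hf v).ne']
  have hM0 : 0 < M := by
    by_contra hneg
    have hz : f₁ = 0 := by
      ext w
      have := hle w
      have h3 : M * f w ≤ 0 := mul_nonpos_of_nonpos_of_nonneg (not_lt.mp hneg) (hf w).le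
      exact abs_nonpos_iff.mp (this.trans h3)
    rw [hz] at h₁
    simp at h₁
  have h4 : adjEigenvalue G 1 * |f₁ v| ≤ M * (t * f v) := by
    calc adjEigenvalue G 1 * |f₁ v| ≤ |adjEigenvalue G 1 * f₁ v| := by
          rw [abs_mul]; gcongr; exact le_abs_self _
      _ = |nbrSum G f₁ v| := by rw [he]; simp
      _ ≤ ∑ w with G.Adj v w, |f₁ w| := Finset.abs_sum_le_sum_abs _ _
      _ ≤ ∑ w with G.Adj v w, M * f w := Finset.sum_le_sum fun w _ => hle w
      _ = M * nbrSum G f v := by rw [nbrSum, Finset.mul_sum]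
      _ ≤ M * (t * f v) := by gcongr; exact h v
  rw [hMv] at h4
  have h5 : 0 < M * f v := mul_pos hM0 (hf v)
  nlinarith

/-- A lower bound for `λ₂` from a two-dimensional space of test vectors. -/
lemma le_adjEigenvalue_two_of_plane (hV : 2 ≤ Fintype.card V) {g₁ g₂ : V → ℝ} {t : ℝ}
    (hind : ∀ a b : ℝ, a • g₁ + b • g₂ = 0 → a = 0 ∧ b = 0)
    (h : ∀ a b : ℝ, t * ((a • g₁ + b • g₂) ⬝ᵥ (a • g₁ + b • g₂)) ≤
      (a • g₁ + b • g₂) ⬝ᵥ nbrSum G (a • g₁ + b • g₂)) : t ≤ adjEigenvalue G 2 := by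
  obtain ⟨f₁, -, -, -, -, -, -, -, -, h2⟩ := exists_top_eigenvectors G hV
  -- a nonzero vector of the plane which is orthogonal to the top eigenvector
  obtain ⟨a, b, hab, hz⟩ : ∃ a b : ℝ, a • g₁ + b • g₂ ≠ 0 ∧ f₁ ⬝ᵥ (a • g₁ + b • g₂) = 0 := by
    by_cases hg : f₁ ⬝ᵥ g₁ = 0
    · refine ⟨1, 0, fun h0 => one_ne_zero (hind _ _ h0).1, ?_⟩
      simp [hg]
    · refine ⟨f₁ ⬝ᵥ g₂, -(f₁ ⬝ᵥ g₁), fun h0 => hg (neg_eq_zero.mp (hind _ _ h0).2), ?_⟩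
      simp only [dotProduct_add, dotProduct_smul, smul_eq_mul]
      ring
  have hpos := dotProduct_self_pos hab
  have := (h a b).trans (h2 _ hz)
  exact le_of_mul_le_mul_right this hpos

lemma le_adjEigenvalue_one (hV : 2 ≤ Fintype.card V) {g : V → ℝ} {t : ℝ} (hg : g ≠ 0)
    (h : t * (g ⬝ᵥ g) ≤ g ⬝ᵥ nbrSum G g) : t ≤ adjEigenvalue G 1 := by
  obtain ⟨-, -, -, -, -, -, -, -, h1, -⟩ := exists_top_eigenvectors G hV
  exact le_of_mul_le_mul_right (h.trans (h1 g)) (dotProduct_self_pos hg)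

/-- Two orthogonal eigenvectors bound `λ₁` and `λ₂` from below. -/
lemma le_adjEigenvalue_of_eigenvectors (hV : 2 ≤ Fintype.card V) {g₁ g₂ : V → ℝ} {μ₁ μ₂ : ℝ}
    (hg₁ : g₁ ≠ 0) (hg₂ : g₂ ≠ 0) (horth : g₁ ⬝ᵥ g₂ = 0) (hμ : μ₂ ≤ μ₁)
    (h₁ : nbrSum G g₁ = μ₁ • g₁) (h₂ : nbrSum G g₂ = μ₂ • g₂) :
    μ₁ ≤ adjEigenvalue G 1 ∧ μ₂ ≤ adjEigenvalue G 2 := by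
  have horth' : g₂ ⬝ᵥ g₁ = 0 := by rw [dotProduct_comm, horth]
  have p₁ := dotProduct_self_pos hg₁
  have p₂ := dotProduct_self_pos hg₂
  refine ⟨le_adjEigenvalue_one hV hg₁ (by rw [h₁]; simp), ?_⟩
  refine le_adjEigenvalue_two_of_plane hV (g₁ := g₁) (g₂ := g₂) ?_ ?_
  · intro a b h0
    constructor
    · have := congrArg (fun z => g₁ ⬝ᵥ z) h0
      simpa [dotProduct_add, horth, p₁.ne'] using this
    · have := congrArg (fun z => g₂ ⬝ᵥ z) h0
      simpa [dotProduct_add, horth', p₂.ne'] using this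
  · intro a b
    simp only [nbrSum_add, nbrSum_smul, h₁, h₂, add_dotProduct, dotProduct_add, smul_dotProduct,
      dotProduct_smul, smul_eq_mul, horth, horth']
    nlinarith [mul_nonneg (sub_nonneg.mpr hμ) (mul_nonneg (sq_nonneg a) p₁.le)]

/-- Eigenvectors of distinct eigenvalues are orthogonal. -/
lemma dotProduct_eq_zero_of_eigenvalue_ne {g₁ g₂ : V → ℝ} {μ₁ μ₂ : ℝ} (hμ : μ₁ ≠ μ₂)
    (h₁ : nbrSum G g₁ = μ₁ • g₁) (h₂ : nbrSum G g₂ = μ₂ • g₂) : g₁ ⬝ᵥ g₂ = 0 := by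
  have := dotProduct_nbrSum_comm G g₁ g₂
  rw [h₁, h₂, dotProduct_smul, smul_dotProduct, smul_eq_mul, smul_eq_mul] at this
  have h3 : (μ₁ - μ₂) * (g₁ ⬝ᵥ g₂) = 0 := by linarith
  exact (mul_eq_zero.mp h3).resolve_left (sub_ne_zero.mpr hμ)

lemma adjEigenvalue_le_of_iso {H : SimpleGraph W} (φ : G ≃g H) (hV : 2 ≤ Fintype.card V) :
    adjEigenvalue H 1 ≤ adjEigenvalue G 1 ∧ adjEigenvalue H 2 ≤ adjEigenvalue G 2 := by
  obtain ⟨f₁, f₂, n₁, n₂, ho, e₁, e₂, hle, -⟩ :=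
    exists_top_eigenvectors H (hV.trans_eq (Fintype.card_congr φ.toEquiv))
  have hd : ∀ y z : W → ℝ, (y ∘ φ) ⬝ᵥ (z ∘ φ) = y ⬝ᵥ z :=
    fun y z => dotProduct_comp_equiv φ.toEquiv y z
  refine le_adjEigenvalue_of_eigenvectors hV (g₁ := f₁ ∘ φ) (g₂ := f₂ ∘ φ) ?_ ?_ ?_ hle ?_ ?_
  · intro h0
    have := hd f₁ f₁
    rw [h0, n₁] at this
    simp at this
  · intro h0
    have := hd f₂ f₂
    rw [h0, n₂] at this
    simp at this
  · rw [hd, ho]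
  · ext v
    rw [nbrSum_comp_iso, e₁]
    rfl
  · ext v
    rw [nbrSum_comp_iso, e₂]
    rfl

lemma Psi_eq_of_iso {H : SimpleGraph W} (φ : G ≃g H) (hV : 2 ≤ Fintype.card V) (α : ℝ) :
    Psi G α = Psi H α := by
  have h := adjEigenvalue_le_of_iso φ hV
  have h' := adjEigenvalue_le_of_iso φ.symm (hV.trans_eq (Fintype.card_congr φ.toEquiv))
  rw [Psi, Psi, le_antisymm h'.1 h.1, le_antisymm h'.2 h.2]

end Spectral

/-! ### The bound `λ₁² + λ₂² ≤ n - 1` for trees -/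

section Bessel

variable {V : Type*} [Fintype V] {G : SimpleGraph V}

open Classical in
/-- Bessel's inequality for the rows of the adjacency matrix: the squares of the eigenvalues of an
orthonormal family of eigenvectors add up to at most twice the number of edges. -/
lemma sum_sq_eigenvalues_le {ι : Type*} [Fintype ι] [DecidableEq ι] (u : ι → V → ℝ) (m : ι → ℝ)
    (horth : ∀ i j, u i ⬝ᵥ u j = if i = j then 1 else 0)
    (heig : ∀ i, nbrSum G (u i) = m i • u i) :
    ∑ i, m i ^ 2 ≤ 2 * (G.edgeFinset.card : ℝ) := by
  have hinner : ∀ x y : EuclideanSpace ℝ V, inner ℝ x y = (x : V → ℝ) ⬝ᵥ (y : V → ℝ) := by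
    intro x y
    simp [PiLp.inner_apply, dotProduct, mul_comm]
  have hon : Orthonormal ℝ fun i => (WithLp.toLp 2 (u i) : EuclideanSpace ℝ V) := by
    rw [orthonormal_iff_ite]
    intro i j
    rw [hinner]
    exact horth i j
  have hrow : ∀ v : V, ∑ i, (m i * u i v) ^ 2 ≤ (G.degree v : ℝ) := by
    intro v
    set r : EuclideanSpace ℝ V := WithLp.toLp 2 fun w => if G.Adj v w then (1 : ℝ) else 0 with hr
    have hB := hon.sum_inner_products_le (s := Finset.univ) r
    have h1 : ∀ i, inner ℝ (WithLp.toLp 2 (u i) : EuclideanSpace ℝ V) r = m i * u i v := by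
      intro i
      have := congrFun (heig i) v
      rw [nbrSum_eq_sum_ite] at this
      rw [hinner]
      simpa [hr, dotProduct] using this
    have h2 : ‖r‖ ^ 2 = (G.degree v : ℝ) := by
      rw [← real_inner_self_eq_norm_sq, hinner]
      simp [hr, dotProduct, ← SimpleGraph.card_neighborFinset_eq_degree,
        SimpleGraph.neighborFinset_eq_filter, ← ite_and]
    simpa [h1, h2, ← mul_pow, ← abs_mul] using hB
  calc ∑ i, m i ^ 2 = ∑ i, ∑ v, (m i * u i v) ^ 2 := by
        refine Finset.sum_congr rfl fun i _ => ?_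
        have h := horth i i
        simp only [if_true, dotProduct] at h
        simp_rw [mul_pow, ← Finset.mul_sum, pow_two (u i _), h, mul_one]
    _ = ∑ v, ∑ i, (m i * u i v) ^ 2 := Finset.sum_comm
    _ ≤ ∑ v, (G.degree v : ℝ) := Finset.sum_le_sum fun v _ => hrow v
    _ = 2 * (G.edgeFinset.card : ℝ) := by
        exact_mod_cast G.sum_degrees_eq_twice_card_edges

lemma adjEigenvalue_one_nonneg (hV : 2 ≤ Fintype.card V) : 0 ≤ adjEigenvalue G 1 := by
  have : Nonempty V := Fintype.card_pos_iff.mp (by omega)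
  refine le_adjEigenvalue_one hV (g := fun _ => 1) ?_ ?_
  · intro h
    exact one_ne_zero (congrFun h (Classical.arbitrary V))
  · rw [zero_mul]
    refine Finset.sum_nonneg fun v _ => mul_nonneg zero_le_one ?_
    exact Finset.sum_nonneg fun _ _ => zero_le_one

/-- A tree on `n` vertices satisfies `λ₁² + λ₂² ≤ n - 1`. The spectrum of a bipartite graph is
symmetric, so that `±λ₁, ±λ₂` all contribute to the sum of the squares of the eigenvalues, which
is twice the number of edges. -/
theorem SimpleGraph.IsTree.sq_adjEigenvalue_add_sq_le (hG : G.IsTree) (hV : 2 ≤ Fintype.card V) :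
    adjEigenvalue G 1 ^ 2 + max (adjEigenvalue G 2) 0 ^ 2 ≤ (Fintype.card V : ℝ) - 1 := by
  classical
  obtain ⟨f₁, f₂, n₁, n₂, ho, e₁, e₂, hle, -⟩ := exists_top_eigenvectors G hV
  have hcard : (G.edgeFinset.card : ℝ) = (Fintype.card V : ℝ) - 1 := by
    have := hG.card_edgeFinset
    rw [← this]
    push_cast
    ring
  -- the sign of the bipartition
  set c := hG.coloringTwo
  set σ : V → ℝ := fun v => if c v = 0 then 1 else -1 with hσ
  have hσσ : ∀ v, σ v * σ v = 1 := by
    intro v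
    by_cases h : c v = 0 <;> simp [hσ, h]
  have hadj : ∀ v w, G.Adj v w → σ w = -σ v := by
    intro v w h
    have hne := c.valid h
    by_cases h1 : c v = 0
    · have h2 : c w ≠ 0 := fun h2 => hne (h1.trans h2.symm)
      simp [hσ, h1, h2]
    · have h2 : c w = 0 := by omega
      simp [hσ, h1, h2]
  have hflip : ∀ (f : V → ℝ) (μ : ℝ), nbrSum G f = μ • f → nbrSum G (σ * f) = (-μ) • (σ * f) := by
    intro f μ hf
    ext v
    have h1 : nbrSum G (σ * f) v = -σ v * nbrSum G f v := by
      rw [nbrSum, nbrSum, Finset.mul_sum]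
      refine Finset.sum_congr rfl fun w hw => ?_
      rw [Pi.mul_apply, hadj v w (Finset.mem_filter.mp hw).2]
    rw [h1, hf]
    simp
    ring
  have hdot : ∀ f g : V → ℝ, (σ * f) ⬝ᵥ (σ * g) = f ⬝ᵥ g := by
    intro f g
    refine Finset.sum_congr rfl fun v _ => ?_
    simp only [Pi.mul_apply]
    linear_combination (f v * g v) * hσσ v
  have hcross : ∀ (f g : V → ℝ) (μ ν : ℝ), 0 < μ → 0 < ν → nbrSum G f = μ • f →
      nbrSum G g = ν • g → f ⬝ᵥ (σ * g) = 0 ∧ (σ * g) ⬝ᵥ f = 0 := by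
    intro f g μ ν hμ hν hf hg
    have := dotProduct_eq_zero_of_eigenvalue_ne (by linarith : μ ≠ -ν) hf (hflip g ν hg)
    exact ⟨this, by rw [dotProduct_comm, this]⟩
  rcases (adjEigenvalue_one_nonneg (G := G) hV).eq_or_lt with h0 | h1
  · have h2 : max (adjEigenvalue G 2) 0 = 0 := max_eq_right (by rw [h0]; exact hle)
    rw [h2, ← h0]
    have : (2 : ℝ) ≤ Fintype.card V := by exact_mod_cast hV
    linarith
  rcases le_or_gt (adjEigenvalue G 2) 0 with h2 | h2
  · rw [max_eq_right h2]
    have := sum_sq_eigenvalues_le (G := G) ![f₁, σ * f₁] ![adjEigenvalue G 1, -adjEigenvalue G 1]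
      (by
        intro i j
        fin_cases i <;> fin_cases j <;> simp [hdot, n₁, hcross f₁ f₁ _ _ h1 h1 e₁ e₁])
      (by
        intro i
        fin_cases i
        · exact e₁
        · exact hflip _ _ e₁)
    simp only [Fin.sum_univ_two, Matrix.cons_val_zero, Matrix.cons_val_one] at this
    rw [hcard] at this
    linarith
  · rw [max_eq_left h2.le]
    have ho' : f₂ ⬝ᵥ f₁ = 0 := by rw [dotProduct_comm, ho]
    have := sum_sq_eigenvalues_le (G := G) ![f₁, f₂, σ * f₁, σ * f₂]
      ![adjEigenvalue G 1, adjEigenvalue G 2, -adjEigenvalue G 1, -adjEigenvalue G 2]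
      (by
        intro i j
        fin_cases i <;> fin_cases j <;>
          simp [hdot, n₁, n₂, ho, ho', hcross f₁ f₁ _ _ h1 h1 e₁ e₁, hcross f₁ f₂ _ _ h1 h2 e₁ e₂,
            hcross f₂ f₁ _ _ h2 h1 e₂ e₁, hcross f₂ f₂ _ _ h2 h2 e₂ e₂])
      (by
        intro i
        fin_cases i
        · exact e₁
        · exact e₂
        · exact hflip _ _ e₁
        · exact hflip _ _ e₂)
    simp [Fin.sum_univ_succ] at this
    rw [hcard] at this
    linarith

end Bessel

/-! ### Trees whose largest eigenvalue is close to that of a star -/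

namespace SimpleGraph

variable {V : Type*} {G : SimpleGraph V}

lemma IsTree.not_adj_of_adj_adj (hG : G.IsTree) {u w x : V} (h₁ : G.Adj u w) (h₂ : G.Adj w x) :
    ¬G.Adj u x := by
  intro h₃
  have c := hG.coloringTwo
  have h1 := c.valid h₁
  have h2 := c.valid h₂
  have h3 := c.valid h₃
  omega

lemma IsTree.eq_of_adj_adj (hG : G.IsTree) {u x w w' : V} (hux : u ≠ x) (h₁ : G.Adj u w)
    (h₂ : G.Adj w x) (h₁' : G.Adj u w') (h₂' : G.Adj w' x) : w = w' := by
  have hp : (Walk.cons h₁ (Walk.cons h₂ Walk.nil)).IsPath := by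
    simp [h₁.ne, h₂.ne, hux]
  have hp' : (Walk.cons h₁' (Walk.cons h₂' Walk.nil)).IsPath := by
    simp [h₁'.ne, h₂'.ne, hux]
  have h := congrArg (fun p : G.Path u x => p.1.support)
    ((hG.isAcyclic.subsingleton_path u x).elim ⟨_, hp⟩ ⟨_, hp'⟩)
  simpa using h

lemma IsTree.not_adj_of_adj_adj_adj_adj (hG : G.IsTree) {u w x y v : V} (h₁ : G.Adj u w)
    (h₂ : G.Adj w x) (h₃ : G.Adj x y) (h₄ : G.Adj y v) : ¬G.Adj v u := by
  intro h₅
  have c := hG.coloringTwo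
  have h1 := c.valid h₁
  have h2 := c.valid h₂
  have h3 := c.valid h₃
  have h4 := c.valid h₄
  have h5 := c.valid h₅
  omega

variable [Fintype V]

open Classical in
/-- The walks of length two from `u`, recorded by their middle vertex and their end. -/
noncomputable def twoWalks (G : SimpleGraph V) (u : V) : Finset (V × V) :=
  {p | G.Adj u p.1 ∧ G.Adj p.1 p.2}

open Classical in
/-- In a tree there are at most `n - 1` walks of length two from a given vertex `u`: send such a
walk to its end, or to its middle vertex if it returns to `u`. If there are exactly `n - 1`, then
every vertex is within distance two of `u`. -/
lemma IsTree.card_twoWalks_le (hG : G.IsTree) (u : V) :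
    (G.twoWalks u).card ≤ Fintype.card V - 1 ∧
      ((G.twoWalks u).card = Fintype.card V - 1 →
        ∀ x ≠ u, G.Adj u x ∨ ∃ w, G.Adj u w ∧ G.Adj w x) := by
  set φ : V × V → V := fun p => if p.2 = u then p.1 else p.2 with hφ
  have hmaps : ∀ p ∈ G.twoWalks u, φ p ∈ Finset.univ.erase u := by
    intro p hp
    simp only [twoWalks, Finset.mem_filter] at hp
    simp only [Finset.mem_erase, Finset.mem_univ, and_true, hφ]
    split_ifs with h
    · exact hp.2.1.ne'
    · exact h
  have hinj : Set.InjOn φ (G.twoWalks u) := by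
    rintro ⟨w, x⟩ hp ⟨w', x'⟩ hp' heq
    simp only [twoWalks, Finset.coe_filter, Finset.mem_univ, true_and, Set.mem_ofPred_eq] at hp hp'
    simp only [hφ] at heq
    split_ifs at heq with h h' h'
    · rw [h, h', heq]
    · subst heq
      exact absurd hp.1 (hG.not_adj_of_adj_adj hp'.1 hp'.2)
    · subst heq
      exact absurd hp'.1 (hG.not_adj_of_adj_adj hp.1 hp.2)
    · subst heq
      rw [hG.eq_of_adj_adj (Ne.symm h) hp.1 hp.2 hp'.1 hp'.2]
  have hcard : (Finset.univ.erase u).card = Fintype.card V - 1 := by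
    rw [Finset.card_erase_of_mem (Finset.mem_univ u), Finset.card_univ]
  refine ⟨hcard ▸ Finset.card_le_card_of_injOn φ hmaps hinj, fun h x hx => ?_⟩
  obtain ⟨⟨w, y⟩, hp, hφp⟩ := Finset.surjOn_of_injOn_of_card_le φ hmaps hinj (by rw [hcard, h])
    (Finset.mem_coe.mpr (Finset.mem_erase.mpr ⟨hx, Finset.mem_univ x⟩))
  simp only [twoWalks, Finset.coe_filter, Finset.mem_univ, true_and, Set.mem_ofPred_eq] at hp
  simp only [hφ] at hφp
  split_ifs at hφp with hy
  · exact Or.inl (hφp ▸ hp.1)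
  · exact Or.inr ⟨w, hp.1, hφp ▸ hp.2⟩

lemma nbrSum_nbrSum (G : SimpleGraph V) (z : V → ℝ) (u : V) :
    nbrSum G (nbrSum G z) u = ∑ p ∈ G.twoWalks u, z p.2 := by
  classical
  simp only [nbrSum_eq_sum_ite, twoWalks, Finset.sum_filter, Fintype.sum_prod_type, ite_and]
  refine Finset.sum_congr rfl fun w _ => ?_
  split_ifs <;> simp

/-- At a vertex `u` where `|z|` is largest, the square of an eigenvalue is bounded by the number of
walks of length two from `u`. -/
lemma sq_eigenvalue_le_card_twoWalks {μ : ℝ} {z : V → ℝ} (he : nbrSum G z = μ • z) {u : V}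
    (hu : z u ≠ 0) (hmax : ∀ x, |z x| ≤ |z u|) : μ ^ 2 ≤ (G.twoWalks u).card := by
  have h1 : μ ^ 2 * z u = ∑ p ∈ G.twoWalks u, z p.2 := by
    rw [← nbrSum_nbrSum, he, nbrSum_smul, he]
    simp
    ring
  have h2 : μ ^ 2 * |z u| ≤ (G.twoWalks u).card * |z u| := by
    calc μ ^ 2 * |z u| = |∑ p ∈ G.twoWalks u, z p.2| := by
          rw [← h1, abs_mul, abs_of_nonneg (sq_nonneg μ)]
      _ ≤ ∑ p ∈ G.twoWalks u, |z p.2| := Finset.abs_sum_le_sum_abs _ _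
      _ ≤ ∑ p ∈ G.twoWalks u, |z u| := Finset.sum_le_sum fun p _ => hmax p.2
      _ = (G.twoWalks u).card * |z u| := by simp
  exact le_of_mul_le_mul_right h2 (abs_pos.mpr hu)

lemma exists_abs_max {z : V → ℝ} (hz : z ≠ 0) : ∃ u, z u ≠ 0 ∧ ∀ x, |z x| ≤ |z u| := by
  obtain ⟨v, hv⟩ := Function.ne_iff.mp hz
  have : Nonempty V := ⟨v⟩
  obtain ⟨u, hu⟩ := Finite.exists_max fun x => |z x|
  exact ⟨u, abs_pos.mp ((abs_pos.mpr hv).trans_le (hu v)), hu⟩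

lemma IsTree.sq_eigenvalue_le (hG : G.IsTree) {μ : ℝ} {z : V → ℝ} (hz : z ≠ 0)
    (he : nbrSum G z = μ • z) : μ ^ 2 ≤ (Fintype.card V : ℝ) - 1 := by
  obtain ⟨u, hu, hmax⟩ := exists_abs_max hz
  have h1 := sq_eigenvalue_le_card_twoWalks he hu hmax
  have h2 := (hG.card_twoWalks_le u).1
  have h3 : 1 ≤ Fintype.card V := Fintype.card_pos_iff.mpr ⟨u⟩
  have h4 : ((G.twoWalks u).card : ℝ) ≤ ((Fintype.card V - 1 : ℕ) : ℝ) := by exact_mod_cast h2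
  rw [Nat.cast_sub h3] at h4
  simpa using h1.trans h4

/-- `G` has a vertex `c` adjacent to all others; for a tree, `G` is then a star with centre `c`. -/
def IsStarAt (G : SimpleGraph V) (c : V) : Prop := ∀ w ≠ c, G.Adj c w

/-- A tree with `m = n - 1` edges and an eigenvalue `μ` whose square is only slightly smaller than
`m` is a star. A vertex `u` where the eigenvector is largest in absolute value has all other
vertices within distance two. Let `q` be the degree of `u`, and let the neighbours `w` of `u` have
`r w` further neighbours, all leaves, with `R = ∑ r w = m - q`. The eigenvalue equation becomes
`1 = ∑ 1 / (μ² - r w)`, and by convexity the right hand side is at most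
`(q + R / (μ² - R)) / μ²`, which is less than `1` unless `R = 0` or `q = 1`. -/
theorem IsTree.exists_isStarAt (hG : G.IsTree) {μ δ : ℝ} (hμ : 0 < μ) {z : V → ℝ} (hz : z ≠ 0)
    (he : nbrSum G z = μ • z) (hδ : μ ^ 2 = (Fintype.card V : ℝ) - 1 - δ) (hδ₁ : δ < 1)
    (hlarge : 2 - δ ^ 2 < (1 - δ) * ((Fintype.card V : ℝ) - 1)) : ∃ c, G.IsStarAt c := by
  classical
  obtain ⟨u, hu, hmax⟩ := exists_abs_max hz
  have h1 := sq_eigenvalue_le_card_twoWalks he hu hmax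
  obtain ⟨h2, hcov⟩ := hG.card_twoWalks_le u
  have h3 : 1 ≤ Fintype.card V := Fintype.card_pos_iff.mpr ⟨u⟩
  have hcard : (G.twoWalks u).card = Fintype.card V - 1 := by
    have : (Fintype.card V : ℝ) < (G.twoWalks u).card + 2 := by linarith
    have : Fintype.card V < (G.twoWalks u).card + 2 := by exact_mod_cast this
    omega
  replace hcov := hcov hcard
  set N : Finset V := {w | G.Adj u w} with hN
  have hdeg : ∑ w ∈ N, ((G.degree w : ℕ) : ℝ) = (Fintype.card V : ℝ) - 1 := by
    have : (G.twoWalks u).card = ∑ w ∈ N, G.degree w := by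
      simp only [twoWalks, hN, Finset.card_eq_sum_ones, Finset.sum_filter, Fintype.sum_prod_type,
        ite_and]
      refine Finset.sum_congr rfl fun w _ => ?_
      split_ifs
      · rw [← card_neighborFinset_eq_degree, neighborFinset_eq_filter, Finset.card_eq_sum_ones,
          Finset.sum_filter]
      · simp
    rw [← Nat.cast_sum, ← this, hcard, Nat.cast_sub h3]
    simp
  set r : V → ℝ := fun w => (G.degree w : ℝ) - 1 with hr
  set q : ℝ := (N.card : ℝ) with hq
  set R : ℝ := (Fintype.card V : ℝ) - 1 - q with hR
  have hrsum : ∑ w ∈ N, r w = R := by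
    simp only [hr, Finset.sum_sub_distrib, hdeg]
    simp [hR, hq]
  have hr0 : ∀ w ∈ N, 0 ≤ r w := by
    intro w hw
    have : 0 < G.degree w := (G.degree_pos_iff_exists_adj w).mpr ⟨u, (by simpa [hN] using hw :
      G.Adj u w).symm⟩
    have : (1 : ℝ) ≤ G.degree w := by exact_mod_cast this
    simp only [hr]
    linarith
  have hrle : ∀ w ∈ N, r w ≤ R := fun w hw => hrsum ▸ Finset.single_le_sum hr0 hw
  rcases Nat.lt_or_ge N.card 2 with hq2 | hq2
  · -- at most one neighbour
    rcases N.eq_empty_or_nonempty with hemp | ⟨w, hw⟩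
    · have hno : ∀ x, ¬G.Adj u x := fun x hx =>
        Finset.notMem_empty x (hemp ▸ (by simpa [hN] using hx : x ∈ N))
      refine ⟨u, fun x hx => ?_⟩
      rcases hcov x hx with h | ⟨w, h, -⟩
      · exact h
      · exact absurd h (hno w)
    · have hall : ∀ x, G.Adj u x → x = w := fun x hx =>
        Finset.card_le_one.mp (by omega) x (by simpa [hN] using hx) w hw
      have huw : G.Adj u w := by simpa [hN] using hw
      refine ⟨w, fun x hx => ?_⟩
      by_cases hxu : x = u
      · exact hxu ▸ huw.symm
      · rcases hcov x hxu with h | ⟨w', h, h'⟩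
        · exact absurd (hall x h) hx
        · exact hall w' h ▸ h'
  have hq2' : (2 : ℝ) ≤ q := by rw [hq]; exact_mod_cast hq2
  rcases (Finset.sum_nonneg hr0).eq_or_lt with hR0 | hRpos
  · -- every neighbour of `u` is a leaf
    refine ⟨u, fun x hx => ?_⟩
    rcases hcov x hx with h | ⟨w, h, h'⟩
    · exact h
    · have hw0 : r w = 0 :=
        (Finset.sum_eq_zero_iff_of_nonneg hr0).mp hR0.symm w (by simpa [hN] using h)
      have hd1 : G.degree w = 1 := by
        have : (G.degree w : ℝ) = 1 := by simp only [hr] at hw0; linarith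
        exact_mod_cast this
      obtain ⟨y, -, hy⟩ := (degree_eq_one_iff_existsUnique_adj).mp hd1
      exact absurd ((hy x h').trans (hy u h.symm).symm) hx
  exfalso
  rw [hrsum] at hRpos
  have hR1 : 1 ≤ R := by
    have h5 : ((Fintype.card V - 1 - N.card : ℤ) : ℝ) = R := by
      simp [hR, hq]
    have h6 : (0 : ℤ) < Fintype.card V - 1 - N.card := by
      rw [← h5] at hRpos
      exact_mod_cast hRpos
    rw [← h5]
    exact_mod_cast h6
  -- the eigenvalue equation at the second layer and at the neighbours of `u`
  have hleaf : ∀ w ∈ N, ∀ x, G.Adj w x → x ≠ u → μ * z x = z w := by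
    intro w hw x hwx hxu
    have huw : G.Adj u w := by simpa [hN] using hw
    have hux : ¬G.Adj u x := hG.not_adj_of_adj_adj huw hwx
    have hN' : ({y | G.Adj x y} : Finset V) = {w} := by
      ext y
      simp only [Finset.mem_filter, Finset.mem_univ, true_and, Finset.mem_singleton]
      constructor
      · intro hy
        have hyu : y ≠ u := fun h => hux (h ▸ hy).symm
        rcases hcov y hyu with h | ⟨v, h, h'⟩
        · exact hG.eq_of_adj_adj hxu hy h.symm hwx.symm huw.symm
        · exact absurd h.symm (hG.not_adj_of_adj_adj_adj_adj huw hwx hy h'.symm)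
      · rintro rfl
        exact hwx.symm
    have := congrFun he x
    rw [nbrSum, hN', Finset.sum_singleton] at this
    exact this.symm
  have hnb : ∀ w ∈ N, (μ ^ 2 - r w) * z w = μ * z u := by
    intro w hw
    have huw : G.Adj u w := by simpa [hN] using hw
    have h5 : μ * z w = nbrSum G z w := by rw [he]; simp
    have hmem : u ∈ G.neighborFinset w := by simpa using huw.symm
    have h6 : nbrSum G z w = z u + ∑ x ∈ (G.neighborFinset w).erase u, z x := by
      rw [nbrSum, ← neighborFinset_eq_filter, Finset.add_sum_erase _ _ hmem]
    have h7 : μ * ∑ x ∈ (G.neighborFinset w).erase u, z x = r w * z w := by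
      rw [Finset.mul_sum, Finset.sum_congr rfl (g := fun _ => z w)]
      · rw [Finset.sum_const, Finset.card_erase_of_mem hmem, card_neighborFinset_eq_degree,
          nsmul_eq_mul, Nat.cast_sub (by
            rw [← card_neighborFinset_eq_degree]; exact Finset.card_pos.mpr ⟨u, hmem⟩)]
        simp [hr]
      · intro x hx
        rw [Finset.mem_erase, mem_neighborFinset] at hx
        exact hleaf w hw x hx.2 hx.1
    linear_combination μ * h5 + μ * h6 + h7
  have hu' : ∑ w ∈ N, z w = μ * z u := by
    have := congrFun he u
    rwa [nbrSum] at this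
  have ht : μ ^ 2 - R = q - δ := by rw [hδ, hR]; ring
  have htR : 0 < μ ^ 2 - R := by linarith
  have ht0 : 0 < μ ^ 2 := by positivity
  have hsum : ∑ w ∈ N, 1 / (μ ^ 2 - r w) = 1 := by
    have h5 : ∑ w ∈ N, 1 / (μ ^ 2 - r w) * (μ * z u) = μ * z u := by
      rw [← hu']
      refine Finset.sum_congr rfl fun w hw => ?_
      have : μ ^ 2 - r w ≠ 0 := by have := hrle w hw; linarith
      rw [hu', ← hnb w hw]
      field_simp
    rw [← Finset.sum_mul] at h5
    have h6 : μ * z u ≠ 0 := mul_ne_zero hμ.ne' hu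
    exact mul_right_cancel₀ h6 (by rw [h5, one_mul])
  have hbound : ∑ w ∈ N, 1 / (μ ^ 2 - r w) ≤ q / μ ^ 2 + R / (μ ^ 2 * (μ ^ 2 - R)) := by
    calc ∑ w ∈ N, 1 / (μ ^ 2 - r w)
        ≤ ∑ w ∈ N, (1 / μ ^ 2 + r w / (μ ^ 2 * (μ ^ 2 - R))) := by
          refine Finset.sum_le_sum fun w hw => ?_
          have h5 : 0 < μ ^ 2 - r w := by have := hrle w hw; linarith
          have h6 : 1 / (μ ^ 2 - r w) = 1 / μ ^ 2 + r w / (μ ^ 2 * (μ ^ 2 - r w)) := by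
            field_simp
            ring
          rw [h6]
          have := hr0 w hw
          have := hrle w hw
          gcongr
      _ = q / μ ^ 2 + R / (μ ^ 2 * (μ ^ 2 - R)) := by
          rw [Finset.sum_add_distrib, Finset.sum_const, nsmul_eq_mul, ← Finset.sum_div N r, hrsum, hq,
            mul_one_div]
  rw [hsum] at hbound
  have h5 : μ ^ 2 * (μ ^ 2 - R) ≤ q * (μ ^ 2 - R) + R := by
    have := mul_le_mul_of_nonneg_right hbound (mul_pos ht0 htR).le
    have h6 : (q / μ ^ 2 + R / (μ ^ 2 * (μ ^ 2 - R))) * (μ ^ 2 * (μ ^ 2 - R)) =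
        q * (μ ^ 2 - R) + R := by
      field_simp
    linarith
  have h6 : μ ^ 2 = q + R - δ := by rw [hδ, hR]; ring
  have h7 : (Fintype.card V : ℝ) - 1 = q + R := by rw [hR]; ring
  rw [h7] at hlarge
  rw [h6] at h5
  nlinarith [mul_nonneg (sub_nonneg.mpr hR1) (sub_nonneg.mpr hq2')]

end SimpleGraph

/-! ### Branches at a vertex of a tree -/

namespace SimpleGraph

variable {V : Type*} {T : SimpleGraph V}

lemma reachable_deleteIncidenceSet_of_walk {v a b : V} (p : T.Walk a b) (hp : v ∉ p.support) :
    (T.deleteIncidenceSet v).Reachable a b := by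
  induction p with
  | nil => exact Reachable.refl _
  | cons h q ih =>
    rw [Walk.support_cons, List.mem_cons, not_or] at hp
    refine Reachable.trans (Adj.reachable (deleteIncidenceSet_adj.mpr ⟨h, Ne.symm hp.1, ?_⟩))
      (ih hp.2)
    rintro rfl
    exact hp.2 q.start_mem_support

lemma deleteIncidenceSet_le_deleteEdges (T : SimpleGraph V) (v u : V) :
    T.deleteIncidenceSet v ≤ T.deleteEdges {s(v, u)} := by
  intro a b hab
  rw [deleteIncidenceSet_adj] at hab
  rw [deleteEdges_adj]
  refine ⟨hab.1, fun h => ?_⟩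
  rw [Set.mem_singleton_iff, Sym2.eq_iff] at h
  rcases h with h | h
  · exact hab.2.1 h.1
  · exact hab.2.2 h.2

lemma IsTree.not_reachable_deleteEdges (hT : T.IsTree) {v u : V} (h : T.Adj v u) :
    ¬(T.deleteEdges {s(v, u)}).Reachable v u :=
  isBridge_iff.mp (isAcyclic_iff_forall_adj_isBridge.mp hT.isAcyclic h)

variable [Fintype V]

open Classical in
/-- The set of vertices which can be reached from `u` without passing through `v`. For adjacent
`v` and `u` in a tree, this is the component of `u` after the removal of `v`; deleting the edges at
`v` instead of `v` itself keeps the vertex type. -/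
noncomputable def branch (T : SimpleGraph V) (v u : V) : Finset V :=
  {w | (T.deleteIncidenceSet v).Reachable u w}

lemma mem_branch {v u w : V} : w ∈ T.branch v u ↔ (T.deleteIncidenceSet v).Reachable u w := by
  simp [branch]

lemma mem_branch_self (T : SimpleGraph V) (v u : V) : u ∈ T.branch v u :=
  mem_branch.mpr (Reachable.refl _)

lemma ne_of_mem_branch {v u w : V} (h : u ≠ v) (hw : w ∈ T.branch v u) : w ≠ v := by
  rintro rfl
  obtain ⟨p⟩ := (mem_branch.mp hw).symm
  cases p with
  | nil => exact h rfl
  | cons h' _ => exact (deleteIncidenceSet_adj.mp h').2.1 rfl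

lemma mem_branch_of_adj {v u a b : V} (hu : u ≠ v) (ha : a ∈ T.branch v u) (hab : T.Adj a b)
    (hb : b ≠ v) : b ∈ T.branch v u :=
  mem_branch.mpr ((mem_branch.mp ha).trans
    (deleteIncidenceSet_adj.mpr ⟨hab, ne_of_mem_branch hu ha, hb⟩).reachable)

lemma IsTree.exists_mem_branch (hT : T.IsTree) {v w : V} (hw : w ≠ v) :
    ∃ u, T.Adj v u ∧ w ∈ T.branch v u := by
  obtain ⟨p, hp⟩ := hT.connected.exists_isPath v w
  cases p with
  | nil => exact absurd rfl hw
  | cons h q =>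
    rw [Walk.cons_isPath_iff] at hp
    exact ⟨_, h, mem_branch.mpr (reachable_deleteIncidenceSet_of_walk q hp.2)⟩

lemma reachable_deleteEdges_of_mem_branch {v u w : V} (hw : w ∈ T.branch v u) (a : V) :
    (T.deleteEdges {s(v, a)}).Reachable u w :=
  (mem_branch.mp hw).mono (deleteIncidenceSet_le_deleteEdges T v a)

/-- A branch at `v` contains only one neighbour of `v`. -/
lemma IsTree.eq_of_mem_branch (hT : T.IsTree) {v u a : V} (hu : T.Adj v u) (ha : T.Adj v a)
    (h : a ∈ T.branch v u) : a = u := by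
  by_contra hne
  refine hT.not_reachable_deleteEdges ha (Reachable.trans (Adj.reachable ?_)
    (reachable_deleteEdges_of_mem_branch h a))
  rw [deleteEdges_adj]
  refine ⟨hu, fun h' => ?_⟩
  rw [Set.mem_singleton_iff, Sym2.eq_iff] at h'
  rcases h' with h' | h'
  · exact hne h'.2.symm
  · exact ha.ne h'.1

lemma IsTree.disjoint_branch (hT : T.IsTree) {v u : V} (h : T.Adj v u) :
    Disjoint (T.branch v u) (T.branch u v) := by
  rw [Finset.disjoint_left]
  intro w hw hw'
  have h1 := reachable_deleteEdges_of_mem_branch hw u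
  have h2 := reachable_deleteEdges_of_mem_branch hw' v
  rw [Sym2.eq_swap] at h2
  exact hT.not_reachable_deleteEdges h (h2.trans h1.symm)

/-- Distinct branches at the same vertex are disjoint. -/
lemma IsTree.disjoint_branch_of_ne (hT : T.IsTree) {v u a : V} (hu : T.Adj v u) (ha : T.Adj v a)
    (hne : u ≠ a) : Disjoint (T.branch v u) (T.branch v a) := by
  rw [Finset.disjoint_left]
  intro w hw hw'
  exact hne (hT.eq_of_mem_branch hu ha
    (mem_branch.mpr ((mem_branch.mp hw).trans (mem_branch.mp hw').symm))).symm

open Classical in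
lemma IsTree.branch_subset (hT : T.IsTree) {v u a : V} (hu : T.Adj v u) (ha : T.Adj u a)
    (hne : a ≠ v) : T.branch u a ⊆ (T.branch v u).erase u := by
  intro w hw
  refine Finset.mem_erase.mpr ⟨ne_of_mem_branch ha.ne' hw, ?_⟩
  have hav : a ∈ T.branch v u := mem_branch_of_adj hu.ne' (mem_branch_self T v u) ha hne
  have key : ∀ x y, (T.deleteIncidenceSet u).Reachable x y → x ∈ T.branch v u →
      x ∈ T.branch u a → y ∈ T.branch v u := by
    rintro x y ⟨p⟩
    induction p with
    | nil => exact fun h _ => h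
    | cons h q ih =>
      intro hx hxa
      rename_i _ b _
      have hb : b ∈ T.branch u a := mem_branch.mpr ((mem_branch.mp hxa).trans h.reachable)
      refine ih (mem_branch_of_adj hu.ne' hx (deleteIncidenceSet_adj.mp h).1 ?_) hb
      rintro rfl
      exact hne (hT.eq_of_mem_branch ha hu.symm hb).symm
  exact key a w (mem_branch.mp hw) hav (mem_branch_self T u a)

/-- A branch of a tree is a tree. -/
lemma IsTree.isTree_induce_branch (hT : T.IsTree) {v u : V} (hu : T.Adj v u) :
    (T.induce (T.branch v u : Set V)).IsTree := by
  have h := (hT.isAcyclic.anti (deleteIncidenceSet_le T v)).isTree_connectedComponent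
    ((T.deleteIncidenceSet v).connectedComponentMk u)
  have hsupp : ((T.deleteIncidenceSet v).connectedComponentMk u).supp =
      (T.branch v u : Set V) := by
    ext w
    simp only [ConnectedComponent.mem_supp_iff, ConnectedComponent.eq, Finset.mem_coe, mem_branch]
    exact reachable_comm
  unfold ConnectedComponent.toSimpleGraph at h
  rw [← induce_deleteIncidenceSet_of_notMem T (x := v)
    (by rw [Finset.mem_coe]; exact fun hv => ne_of_mem_branch hu.ne' hv rfl), ← hsupp]
  exact h

/-- `v` is a centroid of `T`: each of its branches has at most half of the vertices. -/
def IsCentroid (T : SimpleGraph V) (v : V) : Prop :=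
  ∀ u, T.Adj v u → 2 * (T.branch v u).card ≤ Fintype.card V

/-- Every tree has a centroid: the root of a smallest branch having more than half of the
vertices. -/
lemma IsTree.exists_isCentroid (hT : T.IsTree) : ∃ v, T.IsCentroid v := by
  classical
  by_contra! hno
  simp only [IsCentroid, not_forall, not_le] at hno
  have := hT.connected.nonempty
  obtain ⟨v₀⟩ := this
  obtain ⟨u₀, hu₀, hlt₀⟩ := hno v₀
  set S : Finset (V × V) := {p | T.Adj p.1 p.2 ∧ Fintype.card V < 2 * (T.branch p.1 p.2).card}
    with hS
  obtain ⟨⟨v, u⟩, hmem, hmin⟩ := S.exists_min_image (fun p => (T.branch p.1 p.2).card)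
    ⟨(v₀, u₀), by simp [hS, hu₀, hlt₀]⟩
  simp only [hS, Finset.mem_filter, Finset.mem_univ, true_and] at hmem hmin
  obtain ⟨a, ha, hlt⟩ := hno u
  by_cases hav : a = v
  · subst hav
    have h1 := Finset.card_union_of_disjoint (hT.disjoint_branch hmem.1)
    have h2 := Finset.card_le_univ (T.branch a u ∪ T.branch u a)
    omega
  · have h1 := Finset.card_le_card (hT.branch_subset hmem.1 ha hav)
    rw [Finset.card_erase_of_mem (mem_branch_self T v u)] at h1
    have h2 := hmin (u, a) ⟨ha, hlt⟩
    have h3 : 0 < (T.branch v u).card := Finset.card_pos.mpr ⟨u, mem_branch_self T v u⟩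
    simp only at h2
    omega

end SimpleGraph

/-! ### Eigenvectors and branches -/

namespace SimpleGraph

variable {V : Type*} [Fintype V] {T : SimpleGraph V}

lemma nbrSum_deleteIncidenceSet {v : V} {z : V → ℝ} (hz : z v = 0) {a : V} (ha : a ≠ v) :
    nbrSum (T.deleteIncidenceSet v) z a = nbrSum T z a := by
  classical
  rw [nbrSum_eq_sum_ite, nbrSum_eq_sum_ite]
  refine Finset.sum_congr rfl fun b _ => ?_
  by_cases hb : b = v
  · subst hb
    simp [hz]
  · simp [deleteIncidenceSet_adj, ha, hb]

lemma nbrSum_deleteIncidenceSet_self (T : SimpleGraph V) (v : V) (z : V → ℝ) :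
    nbrSum (T.deleteIncidenceSet v) z v = 0 := by
  classical
  rw [nbrSum_eq_sum_ite]
  refine Finset.sum_eq_zero fun b _ => ?_
  simp [deleteIncidenceSet_adj]

lemma dotProduct_nbrSum_deleteIncidenceSet {v : V} {z : V → ℝ} (hz : z v = 0) :
    z ⬝ᵥ nbrSum (T.deleteIncidenceSet v) z = z ⬝ᵥ nbrSum T z := by
  refine Finset.sum_congr rfl fun a _ => ?_
  by_cases ha : a = v
  · subst ha
    simp [hz]
  · rw [nbrSum_deleteIncidenceSet hz ha]

/-- Interlacing: `λ₂(T) ≤ λ₁(T - v)`. If equality holds and `λ₁(T) > λ₂(T)`, then some eigenvector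
for `λ₂(T)` vanishes at `v`. -/
lemma adjEigenvalue_two_le_deleteIncidenceSet (T : SimpleGraph V) (hV : 2 ≤ Fintype.card V)
    (v : V) : adjEigenvalue T 2 ≤ adjEigenvalue (T.deleteIncidenceSet v) 1 ∧
      (adjEigenvalue T 2 < adjEigenvalue T 1 →
        adjEigenvalue (T.deleteIncidenceSet v) 1 ≤ adjEigenvalue T 2 →
        ∃ g, g ≠ 0 ∧ nbrSum T g = adjEigenvalue T 2 • g ∧ g v = 0) := by
  obtain ⟨f₁, f₂, n₁, n₂, ho, e₁, e₂, hle, -⟩ := exists_top_eigenvectors T hV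
  obtain ⟨-, -, -, -, -, -, -, -, hH, -⟩ := exists_top_eigenvectors (T.deleteIncidenceSet v) hV
  have ho' : f₂ ⬝ᵥ f₁ = 0 := by rw [dotProduct_comm, ho]
  have hf₂ : f₂ ≠ 0 := by
    rintro rfl
    simp at n₂
  by_cases h2 : f₂ v = 0
  · refine ⟨?_, fun _ _ => ⟨f₂, hf₂, e₂, h2⟩⟩
    have := hH f₂
    rw [dotProduct_nbrSum_deleteIncidenceSet h2, e₂, dotProduct_smul, n₂] at this
    simpa using this
  · -- the combination of the two eigenvectors which vanishes at `v`
    set z : V → ℝ := f₁ v • f₂ + (-f₂ v) • f₁ with hz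
    have hzv : z v = 0 := by
      simp [hz]
      ring
    have h3 := hH z
    rw [dotProduct_nbrSum_deleteIncidenceSet hzv] at h3
    simp only [hz, nbrSum_add, nbrSum_smul, e₁, e₂, add_dotProduct, dotProduct_add,
      smul_dotProduct, dotProduct_smul, smul_eq_mul, n₁, n₂, ho, ho'] at h3
    have hpos : 0 < f₂ v ^ 2 := by positivity
    set x := adjEigenvalue T 1
    set y := adjEigenvalue T 2
    set t := adjEigenvalue (T.deleteIncidenceSet v) 1
    have h4 : y * (f₁ v ^ 2) + x * f₂ v ^ 2 ≤ t * (f₁ v ^ 2 + f₂ v ^ 2) := by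
      nlinarith [h3]
    constructor
    · by_contra hlt
      push Not at hlt
      nlinarith [sq_nonneg (f₁ v)]
    · intro hxy ht
      exfalso
      nlinarith [sq_nonneg (f₁ v)]

/-- The branch of `T` at `v` through `u` is a star with centre `c`. -/
def IsStarBranch (T : SimpleGraph V) (v u c : V) : Prop :=
  c ∈ T.branch v u ∧ ∀ w ∈ T.branch v u, w ≠ c → T.Adj c w

/-- An eigenvector of `T - v` lives on the branches at `v`. Each branch which it meets is a tree
with that eigenvalue, to which the bounds for trees apply. -/
lemma IsTree.exists_branch_of_eigenvector (hT : T.IsTree) {v : V} {μ : ℝ} (hμ : 0 < μ) {g : V → ℝ}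
    (he : nbrSum (T.deleteIncidenceSet v) g = μ • g) {a : V} (ha : g a ≠ 0) :
    ∃ u, T.Adj v u ∧ a ∈ T.branch v u ∧ μ ^ 2 ≤ ((T.branch v u).card : ℝ) - 1 ∧
      ∀ δ : ℝ, μ ^ 2 = ((T.branch v u).card : ℝ) - 1 - δ → δ < 1 →
        2 - δ ^ 2 < (1 - δ) * (((T.branch v u).card : ℝ) - 1) → ∃ c, T.IsStarBranch v u c := by
  classical
  have hgv : g v = 0 := by
    have := congrFun he v
    rw [nbrSum_deleteIncidenceSet_self] at this
    simpa [hμ.ne'] using this.symm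
  obtain ⟨u, hu, hau⟩ := hT.exists_mem_branch (fun h => ha (h ▸ hgv) : a ≠ v)
  have htree := hT.isTree_induce_branch hu
  set z : ↥(T.branch v u : Set V) → ℝ := fun w => g w with hz
  have hz0 : z ≠ 0 := fun h => ha (congrFun h ⟨a, hau⟩)
  have hzeig : nbrSum (T.induce (T.branch v u : Set V)) z = μ • z := by
    ext ⟨b, hb⟩
    have hb' : b ∈ T.branch v u := hb
    have h1 : nbrSum T g b = μ * g b := by
      rw [← nbrSum_deleteIncidenceSet hgv (ne_of_mem_branch hu.ne' hb'), he]
      simp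
    have h2 : nbrSum T g b = ∑ w ∈ T.branch v u, if T.Adj b w then g w else 0 := by
      rw [nbrSum_eq_sum_ite]
      refine (Finset.sum_subset (Finset.subset_univ _) fun w _ hw => ?_).symm
      by_cases hwv : w = v
      · simp [hwv, hgv]
      · exact if_neg fun h => hw (mem_branch_of_adj hu.ne' hb' h hwv)
    change _ = μ * g b
    rw [nbrSum_eq_sum_ite, ← h1, h2,
      ← Finset.sum_coe_sort (T.branch v u) fun w => if T.Adj b w then g w else 0]
    exact Fintype.sum_equiv (Equiv.refl _) _ _ fun w =>
      if_congr (by simp) rfl rfl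
  have hcard : Fintype.card (T.branch v u : Set V) = (T.branch v u).card := by simp
  refine ⟨u, hu, hau, ?_, fun δ hδ hδ₁ hl => ?_⟩
  · rw [← hcard]
    exact htree.sq_eigenvalue_le hz0 hzeig
  · rw [← hcard] at hδ hl
    obtain ⟨⟨c, hc⟩, hstar⟩ := htree.exists_isStarAt hμ hz0 hzeig hδ hδ₁ hl
    refine ⟨c, hc, fun w hw hwc => ?_⟩
    have := hstar ⟨w, hw⟩ (fun h => hwc (congrArg Subtype.val h))
    simpa using this

section StarBranch

variable {v u c : V} {μ : ℝ} {z : V → ℝ}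

lemma IsTree.eq_of_adj_of_mem_starBranch (hT : T.IsTree) (hu : T.Adj v u)
    (hs : T.IsStarBranch v u c) {w b : V} (hw : w ∈ T.branch v u) (hwc : w ≠ c)
    (hwb : T.Adj w b) : b = c ∨ (b = v ∧ w = u) := by
  by_cases hbv : b = v
  · subst hbv
    exact Or.inr ⟨rfl, hT.eq_of_mem_branch hu hwb.symm hw⟩
  · left
    by_contra hbc
    have hb := mem_branch_of_adj hu.ne' hw hwb hbv
    exact hT.not_adj_of_adj_adj (hs.2 w hw hwc) hwb (hs.2 b hb hbc)

lemma IsTree.eigen_leaf_of_starBranch (hT : T.IsTree) (hu : T.Adj v u)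
    (hs : T.IsStarBranch v u c) (he : nbrSum T z = μ • z) {w : V} (hw : w ∈ T.branch v u)
    (hwc : w ≠ c) (hwu : w ≠ u) : μ * z w = z c := by
  classical
  have h1 : ({b | T.Adj w b} : Finset V) = {c} := by
    ext b
    simp only [Finset.mem_filter, Finset.mem_univ, true_and, Finset.mem_singleton]
    constructor
    · intro h
      exact (hT.eq_of_adj_of_mem_starBranch hu hs hw hwc h).resolve_right fun h' => hwu h'.2
    · rintro rfl
      exact (hs.2 w hw hwc).symm
  have h2 := congrFun he w
  rw [nbrSum, h1, Finset.sum_singleton] at h2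
  simpa using h2.symm

/-- The eigenvalue equation for a star branch attached to `v` at its centre. -/
lemma IsTree.eigen_centre_of_starBranch (hT : T.IsTree) (hu : T.Adj v u)
    (hs : T.IsStarBranch v u u) (he : nbrSum T z = μ • z) :
    (μ ^ 2 - ((T.branch v u).card - 1)) * z u = μ * z v := by
  classical
  have hv : v ∉ (T.branch v u).erase u := fun h =>
    ne_of_mem_branch hu.ne' (Finset.mem_of_mem_erase h) rfl
  have h1 : ({b | T.Adj u b} : Finset V) = insert v ((T.branch v u).erase u) := by
    ext b
    simp only [Finset.mem_filter, Finset.mem_univ, true_and, Finset.mem_insert, Finset.mem_erase]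
    constructor
    · intro h
      by_cases hbv : b = v
      · exact Or.inl hbv
      · exact Or.inr ⟨h.ne', mem_branch_of_adj hu.ne' hs.1 h hbv⟩
    · rintro (rfl | ⟨hb, hb'⟩)
      · exact hu.symm
      · exact hs.2 b hb' hb
  have h2 := congrFun he u
  rw [nbrSum, h1, Finset.sum_insert hv] at h2
  have h3 : μ * ∑ b ∈ (T.branch v u).erase u, z b = ((T.branch v u).card - 1) * z u := by
    rw [Finset.mul_sum, Finset.sum_congr rfl (g := fun _ => z u) fun w hw =>
      hT.eigen_leaf_of_starBranch hu hs he (Finset.mem_of_mem_erase hw) (Finset.ne_of_mem_erase hw)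
        (Finset.ne_of_mem_erase hw)]
    rw [Finset.sum_const, Finset.card_erase_of_mem hs.1, nsmul_eq_mul,
      Nat.cast_sub (Finset.card_pos.mpr ⟨u, hs.1⟩)]
    simp
  simp only [Pi.smul_apply, smul_eq_mul] at h2
  linear_combination -μ * h2 + h3

/-- The eigenvalue equations for a star branch attached to `v` at a leaf `u`. -/
lemma IsTree.eigen_of_starBranch (hT : T.IsTree) (hu : T.Adj v u)
    (hs : T.IsStarBranch v u c) (huc : u ≠ c) (he : nbrSum T z = μ • z) :
    μ * z u = z c + z v ∧ (μ ^ 2 - ((T.branch v u).card - 1)) * z c = z v := by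
  classical
  have hcv : c ≠ v := ne_of_mem_branch hu.ne' hs.1
  have huS := mem_branch_self T v u
  have hleaf : μ * z u = z c + z v := by
    have h1 : ({b | T.Adj u b} : Finset V) = {c, v} := by
      ext b
      simp only [Finset.mem_filter, Finset.mem_univ, true_and, Finset.mem_insert,
        Finset.mem_singleton]
      constructor
      · intro h
        exact (hT.eq_of_adj_of_mem_starBranch hu hs huS huc h).imp_right And.left
      · rintro (rfl | rfl)
        · exact (hs.2 u huS huc).symm
        · exact hu.symm
    have h2 := congrFun he u
    rw [nbrSum, h1, Finset.sum_pair hcv] at h2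
    simpa using h2.symm
  refine ⟨hleaf, ?_⟩
  have h1 : ({b | T.Adj c b} : Finset V) = (T.branch v u).erase c := by
    ext b
    simp only [Finset.mem_filter, Finset.mem_univ, true_and, Finset.mem_erase]
    constructor
    · intro h
      refine ⟨h.ne', mem_branch_of_adj hu.ne' hs.1 h ?_⟩
      rintro rfl
      exact huc (hT.eq_of_mem_branch hu h.symm hs.1).symm
    · exact fun h => hs.2 b h.2 h.1
  have hu' : u ∈ (T.branch v u).erase c := Finset.mem_erase.mpr ⟨huc, huS⟩
  have h2 := congrFun he c
  rw [nbrSum, h1, ← Finset.add_sum_erase _ _ hu'] at h2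
  have h3 : μ * ∑ b ∈ ((T.branch v u).erase c).erase u, z b =
      ((T.branch v u).card - 2) * z c := by
    rw [Finset.mul_sum, Finset.sum_congr rfl (g := fun _ => z c) fun w hw =>
      hT.eigen_leaf_of_starBranch hu hs he
        (Finset.mem_of_mem_erase (Finset.mem_of_mem_erase hw))
        (Finset.ne_of_mem_erase (Finset.mem_of_mem_erase hw)) (Finset.ne_of_mem_erase hw)]
    have h4 : 2 ≤ (T.branch v u).card := by
      have := Finset.card_pos.mpr ⟨u, hu'⟩
      rw [Finset.card_erase_of_mem hs.1] at this
      omega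
    rw [Finset.sum_const, Finset.card_erase_of_mem hu', Finset.card_erase_of_mem hs.1,
      nsmul_eq_mul, Nat.sub_sub, Nat.cast_sub h4]
    simp
  simp only [Pi.smul_apply, smul_eq_mul] at h2
  linear_combination -μ * h2 + h3 + hleaf

end StarBranch

end SimpleGraph

/-! ### Double comets -/

section DoubleComet

variable {k₁ k₂ ℓ : ℕ}

/-- The three kinds of vertices of a double comet. -/
def DCVertex.equivSum (k₁ k₂ ℓ : ℕ) : DCVertex k₁ k₂ ℓ ≃ (Fin k₁ ⊕ Fin k₂) ⊕ Fin ℓ where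
  toFun
    | .leafL i => .inl (.inl i)
    | .leafR i => .inl (.inr i)
    | .path i => .inr i
  invFun
    | .inl (.inl i) => .leafL i
    | .inl (.inr i) => .leafR i
    | .inr i => .path i
  left_inv x := by cases x <;> rfl
  right_inv x := by rcases x with (_ | _) | _ <;> rfl

instance DCVertex.instFintype : Fintype (DCVertex k₁ k₂ ℓ) :=
  Fintype.ofEquiv _ (DCVertex.equivSum k₁ k₂ ℓ).symm

lemma DCVertex.card : Fintype.card (DCVertex k₁ k₂ ℓ) = k₁ + k₂ + ℓ := by
  rw [Fintype.card_congr (DCVertex.equivSum k₁ k₂ ℓ)]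
  simp

lemma DCVertex.sum_eq (f : DCVertex k₁ k₂ ℓ → ℝ) :
    ∑ x, f x = (∑ i, f (.leafL i) + ∑ i, f (.leafR i)) + ∑ i, f (.path i) := by
  rw [← (DCVertex.equivSum k₁ k₂ ℓ).symm.sum_comp, Fintype.sum_sum_type, Fintype.sum_sum_type]
  rfl

lemma DC_adj {x y : DCVertex k₁ k₂ ℓ} : (DC k₁ k₂ ℓ).Adj x y ↔ x.Rel y ∨ y.Rel x := by
  rw [DC, SimpleGraph.fromRel_adj, and_iff_right_iff_imp]
  rintro h rfl
  cases x <;> simp [DCVertex.Rel] at h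

lemma DC_connected (hℓ : 0 < ℓ) : (DC k₁ k₂ ℓ).Connected := by
  have hpath : ∀ (i : ℕ) (hi : i < ℓ),
      (DC k₁ k₂ ℓ).Reachable (.path ⟨0, hℓ⟩) (.path ⟨i, hi⟩) := by
    intro i
    induction i with
    | zero => exact fun _ => SimpleGraph.Reachable.refl _
    | succ i ih =>
      exact fun hi => (ih (by omega)).trans (SimpleGraph.Adj.reachable (DC_adj.mpr (Or.inl rfl)))
  have hall : ∀ x, (DC k₁ k₂ ℓ).Reachable (.path ⟨0, hℓ⟩) x := by
    rintro (i | i | i)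
    · exact SimpleGraph.Adj.reachable (DC_adj.mpr (Or.inr rfl))
    · exact hpath i i.2
    · refine (hpath (ℓ - 1) (by omega)).trans (SimpleGraph.Adj.reachable (DC_adj.mpr (Or.inr ?_)))
      simp only [DCVertex.Rel]
      omega
  exact { preconnected := fun x y => (hall x).symm.trans (hall y), nonempty := ⟨.path ⟨0, hℓ⟩⟩ }

/-- The neighbour of a vertex on its way to the first vertex of the path. -/
def DCVertex.parent (hℓ : 0 < ℓ) : DCVertex k₁ k₂ ℓ → DCVertex k₁ k₂ ℓ
  | .leafL _ => .path ⟨0, hℓ⟩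
  | .path i => .path ⟨i - 1, by omega⟩
  | .leafR _ => .path ⟨ℓ - 1, by omega⟩

lemma DC_isTree (hℓ : 0 < ℓ) : (DC k₁ k₂ ℓ).IsTree := by
  classical
  refine SimpleGraph.isTree_iff_connected_and_card.mpr ⟨DC_connected hℓ, ?_⟩
  refine le_antisymm ?_ (DC_connected hℓ).card_vert_le_card_edgeSet_add_one
  set root : DCVertex k₁ k₂ ℓ := .path ⟨0, hℓ⟩
  -- each edge joins a vertex other than the root to its parent
  have hrel : ∀ x y : DCVertex k₁ k₂ ℓ, x.Rel y → s(x, y) ∈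
      (Finset.univ.erase root).image fun w => s(w, w.parent hℓ) := by
    rintro (i | i | i) (j | j | j) h <;> simp only [DCVertex.Rel] at h
    · refine Finset.mem_image.mpr ⟨.leafL i, by simp [root], ?_⟩
      rw [DCVertex.parent, show j = ⟨0, hℓ⟩ from Fin.ext h]
    · refine Finset.mem_image.mpr ⟨.path j, ?_, ?_⟩
      · simp only [Finset.mem_erase, Finset.mem_univ, and_true, root, ne_eq, DCVertex.path.injEq,
          Fin.ext_iff]
        omega
      · rw [DCVertex.parent, Sym2.eq_swap,
          show (⟨j - 1, by omega⟩ : Fin ℓ) = i from Fin.ext (by simp only; omega)]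
    · refine Finset.mem_image.mpr ⟨.leafR i, by simp [root], ?_⟩
      rw [DCVertex.parent, show j = ⟨ℓ - 1, by omega⟩ from Fin.ext (by simp only; omega)]
  have hsub : (DC k₁ k₂ ℓ).edgeFinset ⊆
      (Finset.univ.erase root).image fun w => s(w, w.parent hℓ) := by
    intro e he
    induction e with
    | h x y =>
      rw [SimpleGraph.mem_edgeFinset, SimpleGraph.mem_edgeSet, DC_adj] at he
      rcases he with h | h
      · exact hrel x y h
      · rw [Sym2.eq_swap]
        exact hrel y x h
  have h1 := (Finset.card_le_card hsub).trans Finset.card_image_le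
  rw [Finset.card_erase_of_mem (Finset.mem_univ _), Finset.card_univ] at h1
  have h2 : 0 < Fintype.card (DCVertex k₁ k₂ ℓ) := Fintype.card_pos_iff.mpr ⟨root⟩
  rw [Nat.card_eq_fintype_card, Nat.card_eq_fintype_card, ← SimpleGraph.edgeFinset_card]
  omega

/-- A bijection from a connected graph to a tree which preserves adjacency is an isomorphism. -/
lemma SimpleGraph.IsTree.nonempty_iso_of_equiv {V W : Type*} {G : SimpleGraph V}
    {T : SimpleGraph W} (hG : G.Connected) (hT : T.IsTree) (e : V ≃ W)
    (he : ∀ a b, G.Adj a b → T.Adj (e a) (e b)) : Nonempty (T ≃g G) := by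
  set φ : T.comap e ≃g T := SimpleGraph.Iso.comap e T
  have hle : G ≤ T.comap e := fun a b h => he a b h
  have hmin := SimpleGraph.isTree_iff_minimal_connected.mp (φ.isTree_iff.mpr hT)
  have heq : T.comap e = G := le_antisymm (hmin.2 hG hle) hle
  exact ⟨heq ▸ φ.symm⟩

/-- A tree is a double comet as soon as the edges of a double comet are found in it. -/
lemma nonempty_iso_DC {V : Type*} [Fintype V] {T : SimpleGraph V} (hT : T.IsTree) (hℓ : 0 < ℓ)
    (p : Fin ℓ → V) (L R : Finset V) (hL : L.card = k₁) (hR : R.card = k₂)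
    (hcard : Fintype.card V = k₁ + k₂ + ℓ) (hp : Function.Injective p) (hpL : ∀ i, p i ∉ L)
    (hpR : ∀ i, p i ∉ R) (hLR : Disjoint L R)
    (hpath : ∀ i j : Fin ℓ, (i : ℕ) + 1 = j → T.Adj (p i) (p j))
    (hadjL : ∀ a ∈ L, T.Adj a (p ⟨0, hℓ⟩)) (hadjR : ∀ a ∈ R, T.Adj a (p ⟨ℓ - 1, by omega⟩)) :
    Nonempty (T ≃g DC k₁ k₂ ℓ) := by
  set eL := (Finset.equivFinOfCardEq hL).symm
  set eR := (Finset.equivFinOfCardEq hR).symm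
  set f : DCVertex k₁ k₂ ℓ → V := fun x =>
    match x with
    | .leafL i => eL i
    | .path i => p i
    | .leafR i => eR i with hf
  have hinj : Function.Injective f := by
    rintro (i | i | i) (j | j | j) h <;> simp only [hf] at h
    · rw [eL.injective (Subtype.ext h)]
    · exact absurd (h ▸ (eL i).2) (hpL j)
    · exact absurd (h ▸ (eR j).2) (Finset.disjoint_left.mp hLR (eL i).2)
    · exact absurd (h ▸ (eL j).2) (hpL i)
    · rw [hp h]
    · exact absurd (h ▸ (eR j).2) (hpR i)
    · exact absurd (h ▸ (eR i).2) (Finset.disjoint_left.mp hLR (eL j).2)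
    · exact absurd (h ▸ (eR i).2) (hpR j)
    · rw [eR.injective (Subtype.ext h)]
  have hbij : Function.Bijective f :=
    (Fintype.bijective_iff_injective_and_card f).mpr ⟨hinj, by rw [DCVertex.card, hcard]⟩
  have hrel : ∀ x y : DCVertex k₁ k₂ ℓ, x.Rel y → T.Adj (f x) (f y) := by
    rintro (i | i | i) (j | j | j) h <;> simp only [DCVertex.Rel] at h
    · rw [show j = ⟨0, hℓ⟩ from Fin.ext h]
      exact hadjL _ (eL i).2
    · exact hpath i j h
    · rw [show j = ⟨ℓ - 1, by omega⟩ from Fin.ext (by simp only; omega)]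
      exact hadjR _ (eR i).2
  refine SimpleGraph.IsTree.nonempty_iso_of_equiv (DC_connected hℓ) hT (Equiv.ofBijective f hbij)
    fun a b hab => ?_
  rcases DC_adj.mp hab with h | h
  · exact hrel a b h
  · exact (hrel b a h).symm

/-! ### The two largest eigenvalues of the extremal double comets -/

/-- The vector on a double comet with value `a` on the left leaves, `b` on the right leaves, and
values `p` along the path. -/
def DCVertex.vec (a : ℝ) (p : Fin ℓ → ℝ) (b : ℝ) : DCVertex k₁ k₂ ℓ → ℝ
  | .leafL _ => a
  | .path i => p i
  | .leafR _ => b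

open DCVertex

lemma vec_add (a a' b b' : ℝ) (p p' : Fin ℓ → ℝ) :
    (vec a p b + vec a' p' b' : DCVertex k₁ k₂ ℓ → ℝ) = vec (a + a') (p + p') (b + b') := by
  ext (i | i | i) <;> simp [vec]

lemma smul_vec (c a b : ℝ) (p : Fin ℓ → ℝ) :
    (c • vec a p b : DCVertex k₁ k₂ ℓ → ℝ) = vec (c * a) (c • p) (c * b) := by
  ext (i | i | i) <;> simp [vec]

lemma dotProduct_vec (a a' b b' : ℝ) (p p' : Fin ℓ → ℝ) :
    (vec a p b : DCVertex k₁ k₂ ℓ → ℝ) ⬝ᵥ vec a' p' b' =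
      (k₁ * (a * a') + k₂ * (b * b')) + ∑ i, p i * p' i := by
  simp [dotProduct, DCVertex.sum_eq, vec]

lemma nbrSum_DC_three (a b : ℝ) (p : Fin 3 → ℝ) :
    nbrSum (DC k₁ k₂ 3) (vec a p b) =
      vec (p 0) ![k₁ * a + p 1, p 0 + p 2, k₂ * b + p 1] (p 2) := by
  classical
  ext x
  simp only [nbrSum_eq_sum_ite, DCVertex.sum_eq, DC_adj]
  rcases x with i | i | i
  · simp [vec, DCVertex.Rel]
  · fin_cases i <;> simp [vec, DCVertex.Rel, Fin.sum_univ_three]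
  · simp [vec, DCVertex.Rel, Fin.sum_univ_three]

lemma nbrSum_DC_four (a b : ℝ) (p : Fin 4 → ℝ) :
    nbrSum (DC k₁ k₂ 4) (vec a p b) =
      vec (p 0) ![k₁ * a + p 1, p 0 + p 2, p 1 + p 3, k₂ * b + p 2] (p 3) := by
  classical
  ext x
  simp only [nbrSum_eq_sum_ite, DCVertex.sum_eq, DC_adj]
  rcases x with i | i | i
  · simp [vec, DCVertex.Rel]
  · fin_cases i <;> simp [vec, DCVertex.Rel, Fin.sum_univ_four]
  · simp [vec, DCVertex.Rel, Fin.sum_univ_four]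

lemma le_adjEigenvalue_DC_three (k : ℕ) (hk : 0 < k) :
    √(k + 2) ≤ adjEigenvalue (DC k k 3) 1 ∧ √k ≤ adjEigenvalue (DC k k 3) 2 := by
  have hk' : (0 : ℝ) < k := by exact_mod_cast hk
  have h1 : (0 : ℝ) < √(k + 2) := Real.sqrt_pos.mpr (by linarith)
  have h2 : (0 : ℝ) < √k := Real.sqrt_pos.mpr hk'
  have s1 : √((k : ℝ) + 2) * √(k + 2) = k + 2 := Real.mul_self_sqrt (by linarith)
  have s2 : √(k : ℝ) * √k = k := Real.mul_self_sqrt hk'.le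
  refine le_adjEigenvalue_of_eigenvectors (by rw [DCVertex.card]; omega)
    (g₁ := vec 1 ![√(k + 2), 2, √(k + 2)] 1) (g₂ := vec 1 ![√k, 0, -√k] (-1)) ?_ ?_ ?_
    (Real.sqrt_le_sqrt (by linarith)) ?_ ?_
  · intro h
    have := congrFun h (.path 1)
    simp [vec] at this
  · intro h
    have := congrFun h (.path 0)
    simp [vec, h2.ne'] at this
  · rw [dotProduct_vec]
    simp [Fin.sum_univ_three]
  · rw [nbrSum_DC_three, smul_vec]
    congr 1
    · simp
    · ext i
      fin_cases i <;> simp [s1]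
      ring
    · simp
  · rw [nbrSum_DC_three, smul_vec]
    congr 1
    · simp
    · ext i
      fin_cases i <;> simp [s2]
    · simp

/-- The squares of the two largest eigenvalues of `DC(k, k + 1, 3)` are at least (in fact equal to)
`k + s` for the two roots `s` of `s² - 3 s + 1 = 0`. -/
lemma le_adjEigenvalue_DC_three_succ (k : ℕ) :
    √(k + (3 + √5) / 2) ≤ adjEigenvalue (DC k (k + 1) 3) 1 ∧
      √(k + (3 - √5) / 2) ≤ adjEigenvalue (DC k (k + 1) 3) 2 := by
  have h5 : √(5 : ℝ) * √5 = 5 := Real.mul_self_sqrt (by norm_num)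
  have h52 : 2 < √(5 : ℝ) := by nlinarith [Real.sqrt_nonneg (5 : ℝ)]
  have h53 : √(5 : ℝ) < 3 := by nlinarith [Real.sqrt_nonneg (5 : ℝ)]
  have hk : (0 : ℝ) ≤ k := by positivity
  have key : ∀ s : ℝ, 0 < s → s - 1 ≠ 0 → s ^ 2 - 3 * s + 1 = 0 →
      nbrSum (DC k (k + 1) 3)
        (vec (s - 1) ![√(k + s) * (s - 1), s * (s - 1), √(k + s) * s] s) =
        √(k + s) • vec (s - 1) ![√(k + s) * (s - 1), s * (s - 1), √(k + s) * s] s := by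
    intro s hs hs1 hroot
    have s1 : √(k + s) * √(k + s) = k + s := Real.mul_self_sqrt (by linarith)
    rw [nbrSum_DC_three, smul_vec]
    congr 1
    ext i
    fin_cases i
    · simp
      linear_combination -(s - 1) * s1
    · simp
      linear_combination -√(k + s) * hroot
    · simp
      linear_combination -s * s1
  have hne : ∀ s : ℝ, 0 < s →
      (vec (s - 1) ![√(k + s) * (s - 1), s * (s - 1), √(k + s) * s] s :
        DCVertex k (k + 1) 3 → ℝ) ≠ 0 := by
    intro s hs h
    have := congrFun h (.leafR 0)
    simp [vec, hs.ne'] at this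
  have e1 := key ((3 + √5) / 2) (by linarith) (by linarith) (by linear_combination h5 / 4)
  have e2 := key ((3 - √5) / 2) (by linarith) (by linarith) (by linear_combination h5 / 4)
  have hlt : √(k + (3 - √5) / 2) < √(k + (3 + √5) / 2) :=
    Real.sqrt_lt_sqrt (by linarith) (by linarith)
  exact le_adjEigenvalue_of_eigenvectors (by rw [DCVertex.card]; omega)
    (hne _ (by linarith)) (hne _ (by linarith))
    (dotProduct_eq_zero_of_eigenvalue_ne hlt.ne' e1 e2) hlt.le e1 e2

/-- The test vectors are the top eigenvectors of the two stars `K_{1,k+1}` obtained by deleting the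
middle edge; the middle edge contributes the error term. -/
lemma le_adjEigenvalue_two_DC_four (k : ℕ) :
    √(k + 1) - 1 / (2 * (k + 1)) ≤ adjEigenvalue (DC k k 4) 2 := by
  set τ := √((k : ℝ) + 1) with hτ
  have hk : (0 : ℝ) ≤ k := by positivity
  have hτ2 : τ * τ = k + 1 := Real.mul_self_sqrt (by linarith)
  have hτ0 : 0 < τ := Real.sqrt_pos.mpr (by linarith)
  refine le_adjEigenvalue_two_of_plane (by rw [DCVertex.card]; omega)
    (g₁ := vec 1 ![τ, 1, 0, 0] 0) (g₂ := vec 0 ![0, 0, 1, τ] 1) ?_ ?_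
  · intro a b h
    rw [smul_vec, smul_vec, vec_add] at h
    have h1 := congrFun h (.path 1)
    have h2 := congrFun h (.path 2)
    simp only [vec] at h1 h2
    exact ⟨by simpa using h1, by simpa using h2⟩
  · intro a b
    rw [smul_vec, smul_vec, vec_add, nbrSum_DC_four, dotProduct_vec, dotProduct_vec]
    simp [Fin.sum_univ_four]
    have h2 : (((k : ℝ) + 1)⁻¹ * 2⁻¹) * (2 * (k + 1)) = 1 := by field_simp
    have h3 : (k : ℝ) = τ * τ - 1 := by linarith
    have h4 : (τ - ((k : ℝ) + 1)⁻¹ * 2⁻¹) * (k * (a * a) + k * (b * b) +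
        (a * τ * (a * τ) + a * a + b * b + b * τ * (b * τ))) =
        (2 * τ ^ 3 - 1) * (a ^ 2 + b ^ 2) := by
      have : k * (a * a) + k * (b * b) + (a * τ * (a * τ) + a * a + b * b + b * τ * (b * τ)) =
          (2 * (k + 1)) * (a ^ 2 + b ^ 2) := by
        linear_combination (a ^ 2 + b ^ 2) * hτ2
      rw [this]
      linear_combination (-(a ^ 2 + b ^ 2)) * h2 - (a ^ 2 + b ^ 2) * 2 * τ * hτ2
    rw [h4]
    rw [h3]
    nlinarith [sq_nonneg (a + b)]

lemma adjEigenvalue_one_DC_four_le (k : ℕ) {t : ℝ} (ht : 1 < t)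
    (h : k + 1 + 1 / (t - 1) ≤ t ^ 2) : adjEigenvalue (DC k k 4) 1 ≤ t := by
  have ht0 : 0 < t := by linarith
  have ht1 : 0 < t - 1 := by linarith
  have h1 : k * t⁻¹ + (t - 1)⁻¹ ≤ t := by
    have : k * t⁻¹ + (t - 1)⁻¹ = (k + 1 + 1 / (t - 1)) / t := by
      field_simp
      ring
    rw [this, div_le_iff₀ ht0]
    linarith
  have h2 : 1 + (t - 1)⁻¹ = t * (t - 1)⁻¹ := by
    field_simp
    ring
  refine adjEigenvalue_one_le_of_supersolution (by rw [DCVertex.card]; omega)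
    (f := vec t⁻¹ ![1, (t - 1)⁻¹, (t - 1)⁻¹, 1] t⁻¹) ?_ ?_
  · rintro (i | i | i)
    · simp [vec, ht0]
    · fin_cases i <;> simp [vec, ht]
    · simp [vec, ht0]
  · intro x
    rw [nbrSum_DC_four]
    rcases x with i | i | i
    · simp [vec, ht0.ne']
    · fin_cases i <;> simp [vec] <;> linarith
    · simp [vec, ht0.ne']

end DoubleComet

/-! ### Trees with a large second eigenvalue -/

namespace SimpleGraph

variable {V : Type*} [Fintype V] {T : SimpleGraph V}

/-- A positive second eigenvalue is bounded through some branch at any given vertex `v`, and if it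
is close to the bound then that branch is a star. -/
lemma IsTree.exists_branch_of_adjEigenvalue_two (hT : T.IsTree) (hV : 2 ≤ Fintype.card V)
    (hpos : 0 < adjEigenvalue T 2) (v : V) :
    ∃ μ u, adjEigenvalue T 2 ≤ μ ∧ T.Adj v u ∧ μ ^ 2 ≤ ((T.branch v u).card : ℝ) - 1 ∧
      ∀ δ : ℝ, μ ^ 2 = ((T.branch v u).card : ℝ) - 1 - δ → δ < 1 →
        2 - δ ^ 2 < (1 - δ) * (((T.branch v u).card : ℝ) - 1) → ∃ c, T.IsStarBranch v u c := by
  have hle := (adjEigenvalue_two_le_deleteIncidenceSet T hV v).1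
  obtain ⟨g, -, hg, -, -, he, -⟩ := exists_top_eigenvectors (T.deleteIncidenceSet v) hV
  obtain ⟨a, ha⟩ : ∃ a, g a ≠ 0 := by
    by_contra! h
    rw [show g = 0 from funext h] at hg
    simp at hg
  obtain ⟨u, hu, -, h1, h2⟩ := hT.exists_branch_of_eigenvector (hpos.trans_le hle) he ha
  exact ⟨_, u, hle, hu, h1, h2⟩

/-- A tree on `n` vertices satisfies `λ₂² ≤ ⌊n / 2⌋ - 1`. -/
theorem IsTree.sq_adjEigenvalue_two_le (hT : T.IsTree) (hV : 2 ≤ Fintype.card V)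
    (hpos : 0 < adjEigenvalue T 2) :
    adjEigenvalue T 2 ^ 2 ≤ ((Fintype.card V / 2 : ℕ) : ℝ) - 1 := by
  obtain ⟨v, hv⟩ := hT.exists_isCentroid
  obtain ⟨μ, u, hμ, hu, h1, -⟩ := hT.exists_branch_of_adjEigenvalue_two hV hpos v
  have h2 : (T.branch v u).card ≤ Fintype.card V / 2 := by
    have := hv u hu
    omega
  have h3 : ((T.branch v u).card : ℝ) ≤ ((Fintype.card V / 2 : ℕ) : ℝ) := by exact_mod_cast h2
  have h4 : adjEigenvalue T 2 ^ 2 ≤ μ ^ 2 := pow_le_pow_left₀ hpos.le hμ 2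
  linarith

/-- An eigenvector which vanishes at `v` and at `u` vanishes on a star branch through `u`. -/
lemma IsTree.eq_zero_of_starBranch (hT : T.IsTree) {v u c : V} {μ : ℝ} {z : V → ℝ} (hμ : μ ≠ 0)
    (hu : T.Adj v u) (hs : T.IsStarBranch v u c) (he : nbrSum T z = μ • z) (hzv : z v = 0)
    (hzu : z u = 0) : ∀ w ∈ T.branch v u, z w = 0 := by
  have hzc : z c = 0 := by
    by_cases huc : u = c
    · exact huc ▸ hzu
    · have := (hT.eigen_of_starBranch hu hs huc he).1
      rw [hzu, hzv] at this
      linarith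
  intro w hw
  by_cases hwc : w = c
  · exact hwc ▸ hzc
  by_cases hwu : w = u
  · exact hwu ▸ hzu
  have := hT.eigen_leaf_of_starBranch hu hs he hw hwc hwu
  rw [hzc] at this
  exact (mul_eq_zero.mp this).resolve_left hμ

/-- The equality case for odd `n = 2 k + 3`. As `λ₂(T - v) = λ₂(T)` at a centroid `v`, the second
eigenvector vanishes at `v`, and its support meets two branches, which have to be stars with `k + 1`
vertices. The eigenvalue equation for `λ₁ = √(k + 2)` shows that both are attached to `v` at their
centres. -/
theorem IsTree.nonempty_iso_DC_of_odd (hT : T.IsTree) {k : ℕ} (hk : 3 ≤ k)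
    (hcard : Fintype.card V = 2 * k + 3) (h₁ : adjEigenvalue T 1 = √(k + 2))
    (h₂ : adjEigenvalue T 2 = √k) : Nonempty (T ≃g DC k k 3) := by
  classical
  have hV : 2 ≤ Fintype.card V := by omega
  have hk' : (3 : ℝ) ≤ k := by exact_mod_cast hk
  have hpos2 : 0 < √(k : ℝ) := Real.sqrt_pos.mpr (by linarith)
  have hpos1 : 0 < √((k : ℝ) + 2) := Real.sqrt_pos.mpr (by linarith)
  have hsq2 : √(k : ℝ) ^ 2 = k := Real.sq_sqrt (by linarith)
  have hsq1 : √((k : ℝ) + 2) ^ 2 = k + 2 := Real.sq_sqrt (by linarith)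
  obtain ⟨v, hv⟩ := hT.exists_isCentroid
  have hbr : ∀ u, T.Adj v u → (T.branch v u).card ≤ k + 1 := by
    intro u hu
    have := hv u hu
    omega
  have hle : adjEigenvalue (T.deleteIncidenceSet v) 1 ≤ adjEigenvalue T 2 := by
    obtain ⟨g, -, hg, -, -, he, -⟩ := exists_top_eigenvectors (T.deleteIncidenceSet v) hV
    rw [h₂]
    rcases le_or_gt (adjEigenvalue (T.deleteIncidenceSet v) 1) 0 with h0 | h0
    · exact h0.trans hpos2.le
    obtain ⟨a, ha⟩ : ∃ a, g a ≠ 0 := by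
      by_contra! h
      rw [show g = 0 from funext h] at hg
      simp at hg
    obtain ⟨u, hu, -, h3, -⟩ := hT.exists_branch_of_eigenvector h0 he ha
    have h4 : ((T.branch v u).card : ℝ) ≤ k + 1 := by exact_mod_cast hbr u hu
    exact Real.le_sqrt_of_sq_le (by linarith)
  obtain ⟨g, hg0, hg, hgv⟩ := (adjEigenvalue_two_le_deleteIncidenceSet T hV v).2
    (by rw [h₁, h₂]; exact Real.sqrt_lt_sqrt (by linarith) (by linarith)) hle
  rw [h₂] at hg
  have hgH : nbrSum (T.deleteIncidenceSet v) g = √(k : ℝ) • g := by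
    ext a
    by_cases ha : a = v
    · subst ha
      rw [nbrSum_deleteIncidenceSet_self]
      simp [hgv]
    · rw [nbrSum_deleteIncidenceSet hgv ha, hg]
  -- each branch met by `g` is a star with `k + 1` vertices
  have hmeet : ∀ a, g a ≠ 0 → ∃ u c, T.Adj v u ∧ a ∈ T.branch v u ∧ T.IsStarBranch v u c ∧
      (T.branch v u).card = k + 1 ∧ g u ≠ 0 := by
    intro a ha
    obtain ⟨u, hu, hau, h3, h4⟩ := hT.exists_branch_of_eigenvector hpos2 hgH ha
    rw [hsq2] at h3 h4
    have h5 : (T.branch v u).card = k + 1 := by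
      have h6 : (k : ℝ) + 1 ≤ (T.branch v u).card := by linarith
      have h7 : k + 1 ≤ (T.branch v u).card := by exact_mod_cast h6
      exact le_antisymm (hbr u hu) h7
    rw [h5] at h4
    push_cast at h4
    obtain ⟨c, hc⟩ := h4 0 (by ring) zero_lt_one (by linarith)
    exact ⟨u, c, hu, hau, hc, h5, fun h0 =>
      ha (hT.eq_zero_of_starBranch hpos2.ne' hu hc hg hgv h0 a hau)⟩
  obtain ⟨a, ha⟩ := Function.ne_iff.mp hg0
  obtain ⟨u, c, hu, -, hs, hsize, hgu⟩ := hmeet a ha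
  -- the equation at `v` provides a second neighbour in the support
  obtain ⟨x, hx, hxu, hgx⟩ : ∃ x, T.Adj v x ∧ x ≠ u ∧ g x ≠ 0 := by
    by_contra! h
    have h3 := congrFun hg v
    rw [nbrSum, Finset.sum_eq_single_of_mem u (by simpa using hu)
      (fun x hx hxu => h x (by simpa using hx) hxu)] at h3
    simp only [Pi.smul_apply, hgv, smul_zero] at h3
    exact hgu h3
  obtain ⟨x', c', hx', hxx', hs', hsize', -⟩ := hmeet x hgx
  obtain rfl := hT.eq_of_mem_branch hx' hx hxx'
  have hdisj := hT.disjoint_branch_of_ne hu hx (Ne.symm hxu)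
  have hvu : v ∉ T.branch v u := fun h => ne_of_mem_branch hu.ne' h rfl
  have hvx : v ∉ T.branch v x := fun h => ne_of_mem_branch hx.ne' h rfl
  have huniv : insert v (T.branch v u ∪ T.branch v x) = Finset.univ := by
    rw [← Finset.card_eq_iff_eq_univ, Finset.card_insert_of_notMem (by simp [hvu, hvx]),
      Finset.card_union_of_disjoint hdisj, hsize, hsize', hcard]
    ring
  have hcover : ∀ w, w = v ∨ w ∈ T.branch v u ∨ w ∈ T.branch v x := by
    intro w
    have := Finset.mem_univ w
    rwa [← huniv, Finset.mem_insert, Finset.mem_union] at this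
  obtain ⟨f, -, hf, -, -, hfe, -⟩ := exists_top_eigenvectors T hV
  rw [h₁] at hfe
  have hNv : ({w | T.Adj v w} : Finset V) = {u, x} := by
    ext w
    simp only [Finset.mem_filter, Finset.mem_univ, true_and, Finset.mem_insert,
      Finset.mem_singleton]
    constructor
    · intro hw
      rcases hcover w with rfl | h | h
      · exact absurd rfl hw.ne
      · exact Or.inl (hT.eq_of_mem_branch hu hw h)
      · exact Or.inr (hT.eq_of_mem_branch hx hw h)
    · rintro (rfl | rfl)
      · exact hu
      · exact hx
  have hv' : f u + f x = √((k : ℝ) + 2) * f v := by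
    have := congrFun hfe v
    rwa [nbrSum, hNv, Finset.sum_pair hxu.symm] at this
  have hfv : f v ≠ 0 := by
    intro h0
    have hu0 : ∀ y d, T.Adj v y → T.IsStarBranch v y d → (T.branch v y).card = k + 1 →
        f y = 0 := by
      intro y d hy hsy hcy
      by_cases hyd : y = d
      · subst hyd
        have := hT.eigen_centre_of_starBranch hy hsy hfe
        rw [hcy, hsq1, h0] at this
        push_cast at this
        linarith
      · have h3 := hT.eigen_of_starBranch hy hsy hyd hfe
        rw [hcy, hsq1, h0] at h3
        push_cast at h3
        have h4 : f d = 0 := by linarith [h3.2]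
        have h5 := h3.1
        rw [h4, add_zero] at h5
        exact (mul_eq_zero.mp h5).resolve_left hpos1.ne'
    have hf0 : f = 0 := by
      ext w
      rcases hcover w with rfl | h | h
      · exact h0
      · exact hT.eq_zero_of_starBranch hpos1.ne' hu hs hfe h0 (hu0 u c hu hs hsize) w h
      · exact hT.eq_zero_of_starBranch hpos1.ne' hx hs' hfe h0 (hu0 x c' hx hs' hsize') w h
    rw [hf0] at hf
    simp at hf
  have hval : ∀ y d, T.Adj v y → T.IsStarBranch v y d → (T.branch v y).card = k + 1 →
      (y = d → 2 * (√((k : ℝ) + 2) * f y) = (k + 2) * f v) ∧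
      (y ≠ d → 2 * (√((k : ℝ) + 2) * f y) = 3 * f v) := by
    intro y d hy hsy hcy
    constructor
    · rintro rfl
      have := hT.eigen_centre_of_starBranch hy hsy hfe
      rw [hcy, hsq1] at this
      push_cast at this
      linear_combination √((k : ℝ) + 2) * this + f v * hsq1
    · intro hyd
      have h3 := hT.eigen_of_starBranch hy hsy hyd hfe
      rw [hcy, hsq1] at h3
      push_cast at h3
      linear_combination 2 * h3.1 + h3.2
  have hsum : 2 * (√((k : ℝ) + 2) * f u) + 2 * (√((k : ℝ) + 2) * f x) =
      2 * (k + 2) * f v := by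
    linear_combination 2 * √((k : ℝ) + 2) * hv' + 2 * f v * hsq1
  obtain ⟨hval1, hval2⟩ := hval u c hu hs hsize
  obtain ⟨hval1', hval2'⟩ := hval x c' hx hs' hsize'
  have huc : u = c := by
    by_contra hne
    have h3 := hval2 hne
    refine hfv ?_
    by_cases hxc : x = c'
    · have h4 := hval1' hxc
      have h5 : ((k : ℝ) - 1) * f v = 0 := by linear_combination h3 + h4 - hsum
      exact (mul_eq_zero.mp h5).resolve_left (by linarith)
    · have h4 := hval2' hxc
      have h5 : (2 * (k : ℝ) - 2) * f v = 0 := by linear_combination h3 + h4 - hsum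
      exact (mul_eq_zero.mp h5).resolve_left (by linarith)
  have hxc : x = c' := by
    by_contra hne
    have h3 := hval2' hne
    have h4 := hval1 huc
    refine hfv ?_
    have h5 : ((k : ℝ) - 1) * f v = 0 := by linear_combination h3 + h4 - hsum
    exact (mul_eq_zero.mp h5).resolve_left (by linarith)
  subst huc hxc
  have hux : u ∉ T.branch v x := Finset.disjoint_left.mp hdisj hs.1
  have hxu' : x ∉ T.branch v u := Finset.disjoint_right.mp hdisj hs'.1
  refine nonempty_iso_DC hT (by norm_num) ![u, v, x] ((T.branch v u).erase u)
    ((T.branch v x).erase x) (by rw [Finset.card_erase_of_mem hs.1, hsize]; rfl)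
    (by rw [Finset.card_erase_of_mem hs'.1, hsize']; rfl) (by omega) ?_ ?_ ?_ ?_ ?_ ?_ ?_
  · intro i j hij
    fin_cases i <;> fin_cases j <;> simp_all [hu.ne, hu.ne', hx.ne, hx.ne', hxu.symm]
  · intro i
    fin_cases i <;> simp [hvu, hxu']
  · intro i
    fin_cases i <;> simp [hvx, hux]
  · exact hdisj.mono (Finset.erase_subset _ _) (Finset.erase_subset _ _)
  · intro i j hij
    fin_cases i <;> fin_cases j <;> simp_all [hu.symm]
  · intro b hb
    exact (hs.2 b (Finset.mem_of_mem_erase hb) (Finset.ne_of_mem_erase hb)).symm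
  · intro b hb
    exact (hs'.2 b (Finset.mem_of_mem_erase hb) (Finset.ne_of_mem_erase hb)).symm

end SimpleGraph

/-! ### Two stars joined by an edge -/

namespace SimpleGraph

variable {V : Type*} [Fintype V] {T : SimpleGraph V}

lemma IsTree.branch_union_branch (hT : T.IsTree) {k : ℕ} (hcard : Fintype.card V = 2 * k + 4)
    {v u : V} (hu : T.Adj v u) (h₁ : (T.branch v u).card = k + 2)
    (h₂ : (T.branch u v).card = k + 2) (w : V) : w ∈ T.branch v u ∨ w ∈ T.branch u v := by
  classical
  have huniv : T.branch v u ∪ T.branch u v = Finset.univ := by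
    rw [← Finset.card_eq_iff_eq_univ, Finset.card_union_of_disjoint (hT.disjoint_branch hu), h₁, h₂,
      hcard]
    ring
  have := Finset.mem_univ w
  rwa [← huniv, Finset.mem_union] at this

/-- Two stars on `k + 2` vertices, with an edge from the centre of one to a leaf of the other. -/
lemma IsTree.nonempty_iso_DC_three (hT : T.IsTree) {k : ℕ} (hcard : Fintype.card V = 2 * k + 4)
    {v u c : V} (hu : T.Adj v u) (h₁ : (T.branch v u).card = k + 2)
    (h₂ : (T.branch u v).card = k + 2) (hs₁ : T.IsStarBranch v u u)
    (hs₂ : T.IsStarBranch u v c) (hvc : v ≠ c) : Nonempty (T ≃g DC k (k + 1) 3) := by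
  classical
  have hdisj := hT.disjoint_branch hu
  have hmem : v ∈ (T.branch u v).erase c := Finset.mem_erase.mpr ⟨hvc, mem_branch_self T u v⟩
  have hcv := hs₂.2 v (mem_branch_self T u v) hvc
  have hv : v ∉ T.branch v u := fun h => ne_of_mem_branch hu.ne' h rfl
  have hu' : u ∉ T.branch u v := fun h => ne_of_mem_branch hu.ne h rfl
  have hc : c ∉ T.branch v u := Finset.disjoint_right.mp hdisj hs₂.1
  have hcu : c ≠ u := fun h => hu' (h ▸ hs₂.1)
  refine nonempty_iso_DC hT (by norm_num) ![c, v, u] (((T.branch u v).erase c).erase v)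
    ((T.branch v u).erase u)
    (by rw [Finset.card_erase_of_mem hmem, Finset.card_erase_of_mem hs₂.1, h₂]; rfl)
    (by rw [Finset.card_erase_of_mem hs₁.1, h₁]; rfl) (by omega) ?_ ?_ ?_ ?_ ?_ ?_ ?_
  · intro i j hij
    fin_cases i <;> fin_cases j <;> simp_all [hu.ne, hu.ne', hvc.symm, hcu.symm]
  · intro i
    fin_cases i <;> simp [hu']
  · intro i
    fin_cases i <;> simp [hv, hc]
  · exact hdisj.symm.mono ((Finset.erase_subset _ _).trans (Finset.erase_subset _ _))
      (Finset.erase_subset _ _)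
  · intro i j hij
    fin_cases i <;> fin_cases j <;> simp_all
  · intro b hb
    have hb' := Finset.mem_of_mem_erase hb
    exact (hs₂.2 b (Finset.mem_of_mem_erase hb') (Finset.ne_of_mem_erase hb')).symm
  · intro b hb
    exact (hs₁.2 b (Finset.mem_of_mem_erase hb) (Finset.ne_of_mem_erase hb)).symm

/-- Two stars on `k + 2` vertices, with an edge joining a leaf of each. -/
lemma IsTree.nonempty_iso_DC_four (hT : T.IsTree) {k : ℕ} (hcard : Fintype.card V = 2 * k + 4)
    {v u c d : V} (hu : T.Adj v u) (h₁ : (T.branch v u).card = k + 2)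
    (h₂ : (T.branch u v).card = k + 2) (hs₁ : T.IsStarBranch v u c)
    (hs₂ : T.IsStarBranch u v d) (huc : u ≠ c) (hvd : v ≠ d) : Nonempty (T ≃g DC k k 4) := by
  classical
  have hdisj := hT.disjoint_branch hu
  have hmem₁ : u ∈ (T.branch v u).erase c := Finset.mem_erase.mpr ⟨huc, mem_branch_self T v u⟩
  have hmem₂ : v ∈ (T.branch u v).erase d := Finset.mem_erase.mpr ⟨hvd, mem_branch_self T u v⟩
  have hcu := hs₁.2 u (mem_branch_self T v u) huc
  have hdv := hs₂.2 v (mem_branch_self T u v) hvd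
  have hv : v ∉ T.branch v u := fun h => ne_of_mem_branch hu.ne' h rfl
  have hu' : u ∉ T.branch u v := fun h => ne_of_mem_branch hu.ne h rfl
  have hd : d ∉ T.branch v u := Finset.disjoint_right.mp hdisj hs₂.1
  have hc : c ∉ T.branch u v := Finset.disjoint_left.mp hdisj hs₁.1
  have hcv : c ≠ v := fun h => hv (h ▸ hs₁.1)
  have hdu : d ≠ u := fun h => hu' (h ▸ hs₂.1)
  have hcd : c ≠ d := fun h => hd (h ▸ hs₁.1)
  refine nonempty_iso_DC hT (by norm_num) ![c, u, v, d] (((T.branch v u).erase c).erase u)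
    (((T.branch u v).erase d).erase v)
    (by rw [Finset.card_erase_of_mem hmem₁, Finset.card_erase_of_mem hs₁.1, h₁]; rfl)
    (by rw [Finset.card_erase_of_mem hmem₂, Finset.card_erase_of_mem hs₂.1, h₂]; rfl)
    (by omega) ?_ ?_ ?_ ?_ ?_ ?_ ?_
  · intro i j hij
    fin_cases i <;> fin_cases j <;>
      simp_all [hu.ne, hu.ne', huc.symm, hvd.symm, hcv.symm, hdu.symm, hcd.symm]
  · intro i
    fin_cases i <;> simp [hv, hd]
  · intro i
    fin_cases i <;> simp [hu', hc]
  · exact hdisj.mono ((Finset.erase_subset _ _).trans (Finset.erase_subset _ _))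
      ((Finset.erase_subset _ _).trans (Finset.erase_subset _ _))
  · intro i j hij
    fin_cases i <;> fin_cases j <;> simp_all [hu.symm, hdv.symm]
  · intro b hb
    have hb' := Finset.mem_of_mem_erase hb
    exact (hs₁.2 b (Finset.mem_of_mem_erase hb') (Finset.ne_of_mem_erase hb')).symm
  · intro b hb
    have hb' := Finset.mem_of_mem_erase hb
    exact (hs₂.2 b (Finset.mem_of_mem_erase hb') (Finset.ne_of_mem_erase hb')).symm

/-- For even `n = 2 k + 4`, a tree whose second eigenvalue is at least that of `DC(k, k + 1, 3)` is
one of the two extremal double comets. At a centroid `v` there is a branch with half of the vertices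
which is a star; its root `u` is again a centroid, so that the other half is a star as well. If the
edge `vu` joined the two centres, then `(λ₂² - (k + 1))² = λ₂²`, which is impossible. -/
theorem IsTree.nonempty_iso_DC_of_even (hT : T.IsTree) {k : ℕ} (hk : 5 ≤ k)
    (hcard : Fintype.card V = 2 * k + 4)
    (h₂ : √(k + (3 - √5) / 2) ≤ adjEigenvalue T 2) :
    Nonempty (T ≃g DC k k 4) ∨ Nonempty (T ≃g DC k (k + 1) 3) := by
  classical
  have hV : 2 ≤ Fintype.card V := by omega
  have hk' : (5 : ℝ) ≤ k := by exact_mod_cast hk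
  have h5 : √(5 : ℝ) * √5 = 5 := Real.mul_self_sqrt (by norm_num)
  have h53 : √(5 : ℝ) < 2.24 := by nlinarith [Real.sqrt_nonneg (5 : ℝ)]
  have hpos : 0 < adjEigenvalue T 2 := (Real.sqrt_pos.mpr (by linarith)).trans_le h₂
  -- `0.38 < (3 - √5) / 2`; the loss `δ ≤ 0.62` in the star criterion is small enough for `k ≥ 5`
  have hsq : (k : ℝ) + 0.38 ≤ adjEigenvalue T 2 ^ 2 := by
    have h3 : √((k : ℝ) + (3 - √5) / 2) ^ 2 = k + (3 - √5) / 2 := Real.sq_sqrt (by linarith)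
    have h4 := pow_le_pow_left₀ (Real.sqrt_nonneg _) h₂ 2
    linarith
  have hcent : ∀ v, T.IsCentroid v → ∃ u c, T.Adj v u ∧ (T.branch v u).card = k + 2 ∧
      T.IsStarBranch v u c := by
    intro v hv
    obtain ⟨μ, u, hμ, hu, h3, h4⟩ := hT.exists_branch_of_adjEigenvalue_two hV hpos v
    have h6 : adjEigenvalue T 2 ^ 2 ≤ μ ^ 2 := pow_le_pow_left₀ hpos.le hμ 2
    have h7 : (T.branch v u).card = k + 2 := by
      have h8 : (k : ℝ) + 1 < (T.branch v u).card := by linarith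
      have h9 : k + 1 < (T.branch v u).card := by exact_mod_cast h8
      have := hv u hu
      omega
    rw [h7] at h3 h4
    push_cast at h3 h4
    obtain ⟨c, hc⟩ := h4 (k + 1 - μ ^ 2) (by ring) (by linarith) (by nlinarith)
    exact ⟨u, c, hu, h7, hc⟩
  obtain ⟨v, hv⟩ := hT.exists_isCentroid
  obtain ⟨u, c, hu, hsize, hs⟩ := hcent v hv
  have hsmall : ∀ a, T.Adj u a → a ≠ v → (T.branch u a).card ≤ k + 1 := by
    intro a ha hav
    have := Finset.card_le_card (hT.branch_subset hu ha hav)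
    rwa [Finset.card_erase_of_mem (mem_branch_self T v u), hsize] at this
  have hcu : T.IsCentroid u := by
    intro a ha
    by_cases hav : a = v
    · subst hav
      have h3 := Finset.card_union_of_disjoint (hT.disjoint_branch hu)
      have h4 := Finset.card_le_univ (T.branch a u ∪ T.branch u a)
      omega
    · have := hsmall a ha hav
      omega
  obtain ⟨a, d, ha, hsize', hs'⟩ := hcent u hcu
  obtain rfl : a = v := by
    by_contra hav
    have := hsmall a ha hav
    omega
  by_cases huc : u = c
  · by_cases had : a = d
    · exfalso
      subst huc had
      have hub : adjEigenvalue T 2 ^ 2 ≤ k + 1 := by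
        have := hT.sq_adjEigenvalue_two_le hV hpos
        rw [hcard, show (2 * k + 4) / 2 = k + 2 by omega] at this
        push_cast at this
        linarith
      obtain ⟨-, f, -, hf, -, -, hfe, -⟩ := exists_top_eigenvectors T hV
      have e1 := hT.eigen_centre_of_starBranch hu hs hfe
      have e2 := hT.eigen_centre_of_starBranch ha hs' hfe
      rw [hsize] at e1
      rw [hsize'] at e2
      push_cast at e1 e2
      have hfu : f u ≠ 0 := by
        intro h0
        have h1 : f a = 0 := by
          rw [h0, mul_zero] at e1
          exact (mul_eq_zero.mp e1.symm).resolve_left hpos.ne'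
        have hf0 : f = 0 := by
          ext w
          rcases hT.branch_union_branch hcard hu hsize hsize' w with h | h
          · exact hT.eq_zero_of_starBranch hpos.ne' hu hs hfe h1 h0 w h
          · exact hT.eq_zero_of_starBranch hpos.ne' ha hs' hfe h0 h1 w h
        rw [hf0] at hf
        simp at hf
      have h3 : (adjEigenvalue T 2 ^ 2 - (k + 1)) ^ 2 = adjEigenvalue T 2 ^ 2 := by
        refine mul_right_cancel₀ hfu ?_
        linear_combination (adjEigenvalue T 2 ^ 2 - (k + 1)) * e1 + adjEigenvalue T 2 * e2
      nlinarith
    · subst huc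
      exact Or.inr (hT.nonempty_iso_DC_three hcard hu hsize hsize' hs hs' had)
  · by_cases had : a = d
    · subst had
      exact Or.inr (hT.nonempty_iso_DC_three hcard ha hsize' hsize hs' hs huc)
    · exact Or.inl (hT.nonempty_iso_DC_four hcard hu hsize hsize' hs hs' huc had)

end SimpleGraph

/-! ### Maximizing `α x + (1 - α) y` -/

section Optimization

/-- For `α ≤ 1 / 2` and `q < p`, the value of `α x + (1 - α) y` on the part `y < q` of the disc
`x² + y² ≤ p² + q²` stays below its value at `(p, q)`. For `y < 0` only `x² ≤ p² + q²` is needed. -/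
lemma convexComb_lt {α p q x y : ℝ} (hα₀ : 0 < α) (hα₁ : α ≤ 1 / 2) (hq : 0 < q) (hqp : q < p)
    (h : x ^ 2 + max y 0 ^ 2 ≤ p ^ 2 + q ^ 2) (hy : y < q) :
    α * x + (1 - α) * y < α * p + (1 - α) * q := by
  set m := max y 0 with hm
  have hmq : m < q := max_lt hy hq
  have hym : y ≤ m := le_max_left _ _
  have h1 : p * (x - p) ≤ q * (q - m) := by nlinarith [sq_nonneg (x - p), sq_nonneg (m - q)]
  have h2 : p * (α * (x - p)) < p * ((1 - α) * (q - m)) := by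
    have h3 : α * q < (1 - α) * p := by nlinarith
    nlinarith [mul_le_mul_of_nonneg_left h1 hα₀.le, mul_lt_mul_of_pos_right h3 (sub_pos.mpr hmq)]
  have h4 := lt_of_mul_lt_mul_left h2 (by linarith)
  nlinarith [mul_le_mul_of_nonneg_left hym (by linarith : 0 ≤ 1 - α)]

lemma eq_of_le_convexComb {α p q x y : ℝ} (hα₀ : 0 < α) (hα₁ : α ≤ 1 / 2) (hq : 0 < q)
    (hqp : q < p) (h : x ^ 2 + max y 0 ^ 2 ≤ p ^ 2 + q ^ 2) (hy : y ≤ q)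
    (hle : α * p + (1 - α) * q ≤ α * x + (1 - α) * y) : x = p ∧ y = q := by
  rcases hy.lt_or_eq with hlt | rfl
  · exact absurd (convexComb_lt hα₀ hα₁ hq hqp h hlt) (not_lt.mpr hle)
  · have h1 : p ≤ x := le_of_mul_le_mul_left (by linarith) hα₀
    rw [max_eq_left hq.le] at h
    exact ⟨by nlinarith, rfl⟩

/-- Lower bounds `p`, `q` for the two largest eigenvalues of a tree which exhaust
`λ₁² + λ₂² ≤ n - 1` are attained. -/
lemma SimpleGraph.IsTree.adjEigenvalue_eq {V : Type*} [Fintype V] {T : SimpleGraph V}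
    (hT : T.IsTree) (hV : 2 ≤ Fintype.card V) {p q : ℝ} (hp : 0 ≤ p) (hq : 0 ≤ q)
    (hpq : p ^ 2 + q ^ 2 = (Fintype.card V : ℝ) - 1) (h₁ : p ≤ adjEigenvalue T 1)
    (h₂ : q ≤ adjEigenvalue T 2) : adjEigenvalue T 1 = p ∧ adjEigenvalue T 2 = q := by
  have h := hT.sq_adjEigenvalue_add_sq_le hV
  rw [max_eq_left (hq.trans h₂), ← hpq] at h
  have h3 := pow_le_pow_left₀ hp h₁ 2
  have h4 := pow_le_pow_left₀ hq h₂ 2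
  exact ⟨(pow_left_inj₀ (hp.trans h₁) hp two_ne_zero).mp (by linarith),
    (pow_left_inj₀ (hq.trans h₂) hq two_ne_zero).mp (by linarith)⟩

open Filter Topology in
lemma tendsto_sqrt_mul_sqrt_add_sub (c : ℝ) :
    Tendsto (fun x : ℝ => √x * (√(x + c) - √x)) atTop (𝓝 (c / 2)) := by
  have h1 : Tendsto (fun x : ℝ => c / (√(1 + c / x) + 1)) atTop (𝓝 (c / (√(1 + 0) + 1))) := by
    refine Tendsto.div tendsto_const_nhds (Tendsto.add ?_ tendsto_const_nhds) (by positivity)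
    exact (Real.continuous_sqrt.tendsto _).comp
      (tendsto_const_nhds.add (tendsto_const_nhds.div_atTop tendsto_id))
  have h2 : c / (√(1 + 0) + 1) = c / 2 := by norm_num
  rw [h2] at h1
  refine h1.congr' ?_
  filter_upwards [eventually_gt_atTop 0, eventually_gt_atTop (-c)] with x hx hxc
  have hx' : 0 < √x := Real.sqrt_pos.mpr hx
  have h3 : √(x + c) = √x * √(1 + c / x) := by
    rw [← Real.sqrt_mul hx.le]
    congr 1
    field_simp
  have hy : 0 ≤ 1 + c / x := by
    have : 1 + c / x = (x + c) / x := by field_simp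
    rw [this]
    exact div_nonneg (by linarith) hx.le
  have h4 : √x * √x = x := Real.mul_self_sqrt hx.le
  have h5 : √(1 + c / x) * √(1 + c / x) = 1 + c / x := Real.mul_self_sqrt hy
  rw [h3, div_eq_iff (by positivity)]
  have h6 : x * (c / x) = c := by field_simp
  linear_combination (-1 - √(1 + c / x) ^ 2 + 2) * h4 - x * h5 - h6

end Optimization

/-! ### Comparison of the double comets on an even number of vertices -/

section Comparison

open Filter Topology

lemma adjEigenvalue_DC_three_succ (k : ℕ) :
    adjEigenvalue (DC k (k + 1) 3) 1 = √(k + (3 + √5) / 2) ∧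
      adjEigenvalue (DC k (k + 1) 3) 2 = √(k + (3 - √5) / 2) := by
  have h5 : √(5 : ℝ) * √5 = 5 := Real.mul_self_sqrt (by norm_num)
  have h53 : √(5 : ℝ) < 3 := by nlinarith [Real.sqrt_nonneg (5 : ℝ)]
  have h50 := Real.sqrt_nonneg (5 : ℝ)
  have hk : (0 : ℝ) ≤ k := by positivity
  obtain ⟨h1, h2⟩ := le_adjEigenvalue_DC_three_succ k
  refine (DC_isTree (by norm_num)).adjEigenvalue_eq (by rw [DCVertex.card]; omega)
    (Real.sqrt_nonneg _) (Real.sqrt_nonneg _) ?_ h1 h2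
  rw [Real.sq_sqrt (by linarith), Real.sq_sqrt (by linarith), DCVertex.card]
  push_cast
  ring

lemma adjEigenvalue_two_DC_four_le (k : ℕ) : adjEigenvalue (DC k k 4) 2 ≤ √(k + 1) := by
  rcases le_or_gt (adjEigenvalue (DC k k 4) 2) 0 with h0 | h0
  · exact h0.trans (Real.sqrt_nonneg _)
  · have h := (DC_isTree (k₁ := k) (k₂ := k) (ℓ := 4) (by norm_num)).sq_adjEigenvalue_two_le
      (by rw [DCVertex.card]; omega) h0
    rw [DCVertex.card, show (k + k + 4) / 2 = k + 2 by omega] at h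
    push_cast at h
    exact Real.le_sqrt_of_sq_le (by linarith)

lemma le_Psi_DC_four (k : ℕ) {α : ℝ} (hα₀ : 0 < α) :
    √(k + 1) - 1 / (2 * (k + 1)) ≤ Psi (DC k k 4) α := by
  have h1 := le_adjEigenvalue_two_DC_four k
  obtain ⟨-, -, -, -, -, -, -, h2, -⟩ :=
    exists_top_eigenvectors (DC k k 4) (by rw [DCVertex.card]; omega)
  rw [Psi]
  nlinarith

lemma tendsto_natCast_add_one : Tendsto (fun k : ℕ => (k : ℝ) + 1) atTop atTop :=
  tendsto_atTop_add_const_right _ _ tendsto_natCast_atTop_atTop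

/-- To the order `1 / √k`, `Ψ(DC(k, k + 1, 3), α)` exceeds `√(k + 1)` by a multiple of
`1 - (1 - 2 α) √5`, which changes sign at `α = (√5 - 1) / (2 √5)`. -/
lemma tendsto_Psi_DC_three_succ (α : ℝ) :
    Tendsto (fun k : ℕ => √((k : ℝ) + 1) * (Psi (DC k (k + 1) 3) α - √(k + 1))) atTop
      (𝓝 ((1 - (1 - 2 * α) * √5) / 4)) := by
  have h1 := (tendsto_sqrt_mul_sqrt_add_sub ((1 + √5) / 2)).comp tendsto_natCast_add_one
  have h2 := (tendsto_sqrt_mul_sqrt_add_sub ((1 - √5) / 2)).comp tendsto_natCast_add_one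
  have h3 := (h1.const_mul α).add (h2.const_mul (1 - α))
  have h4 : α * ((1 + √5) / 2 / 2) + (1 - α) * ((1 - √5) / 2 / 2) =
      (1 - (1 - 2 * α) * √5) / 4 := by ring
  rw [h4] at h3
  refine h3.congr fun k => ?_
  simp only [Function.comp_apply]
  rw [Psi, (adjEigenvalue_DC_three_succ k).1, (adjEigenvalue_DC_three_succ k).2,
    show (k : ℝ) + 1 + (1 + √5) / 2 = k + (3 + √5) / 2 by ring,
    show (k : ℝ) + 1 + (1 - √5) / 2 = k + (3 - √5) / 2 by ring]
  ring

lemma eventually_Psi_DC_three_succ_lt {α : ℝ} (hα₀ : 0 < α) (hα : α < (√5 - 1) / (2 * √5)) :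
    ∀ᶠ k : ℕ in atTop, Psi (DC k (k + 1) 3) α < Psi (DC k k 4) α := by
  have h5 : 0 < √(5 : ℝ) := Real.sqrt_pos.mpr (by norm_num)
  rw [lt_div_iff₀ (by positivity)] at hα
  have h1 : Tendsto (fun k : ℕ => -(1 / (2 * √((k : ℝ) + 1)))) atTop (𝓝 (-0)) := by
    refine Tendsto.neg (Tendsto.div_atTop tendsto_const_nhds ?_)
    exact (Real.tendsto_sqrt_atTop.comp tendsto_natCast_add_one).const_mul_atTop two_pos
  filter_upwards [(tendsto_Psi_DC_three_succ α).eventually_lt h1 (by linarith)] with k hk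
  refine lt_of_lt_of_le ?_ (le_Psi_DC_four k hα₀)
  have h2 : 0 < √((k : ℝ) + 1) := Real.sqrt_pos.mpr (by positivity)
  have h3 : √((k : ℝ) + 1) * √((k : ℝ) + 1) = k + 1 := Real.mul_self_sqrt (by positivity)
  have h4 : -(1 / (2 * √((k : ℝ) + 1))) = √((k : ℝ) + 1) * -(1 / (2 * (k + 1))) := by
    rw [mul_neg, neg_inj, mul_one_div, div_eq_div_iff (by positivity) (by positivity)]
    linear_combination -2 * h3
  rw [h4] at hk
  have := lt_of_mul_lt_mul_left hk h2.le
  linarith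

lemma eventually_Psi_DC_four_lt {α : ℝ} (hα₀ : 0 < α) (hα₁ : α ≤ 1 / 2)
    (hα : (√5 - 1) / (2 * √5) < α) :
    ∀ᶠ k : ℕ in atTop, Psi (DC k k 4) α < Psi (DC k (k + 1) 3) α := by
  have h5 : 0 < √(5 : ℝ) := Real.sqrt_pos.mpr (by norm_num)
  rw [div_lt_iff₀ (by positivity)] at hα
  set ε := (1 - (1 - 2 * α) * √5) / 4 with hε
  have hε0 : 0 < ε := by rw [hε]; linarith
  have h1 := ((tendsto_sqrt_mul_sqrt_add_sub ε).comp tendsto_natCast_add_one).const_mul α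
  filter_upwards [h1.eventually_lt (tendsto_Psi_DC_three_succ α) (by rw [← hε]; nlinarith),
    tendsto_natCast_add_one.eventually_ge_atTop ((1 / ε + 1) ^ 2)] with k hk hlarge
  simp only [Function.comp_apply] at hk
  have h2 : 0 < √((k : ℝ) + 1) := Real.sqrt_pos.mpr (by positivity)
  set t := √((k : ℝ) + 1 + ε) with ht
  have htsq : t ^ 2 = k + 1 + ε := Real.sq_sqrt (by positivity)
  have ht1 : 1 / ε + 1 ≤ t := Real.le_sqrt_of_sq_le (by linarith)
  have hεinv : 0 < 1 / ε := by positivity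
  have ht2 : 1 / (t - 1) ≤ ε := by
    rw [div_le_iff₀ (by linarith)]
    have : ε * (1 / ε) = 1 := by field_simp
    nlinarith
  have hb1 := adjEigenvalue_one_DC_four_le k (t := t) (by linarith) (by linarith)
  have hb2 := adjEigenvalue_two_DC_four_le k
  have h3 : α * (√((k : ℝ) + 1) * (t - √(k + 1))) = √((k : ℝ) + 1) * (α * (t - √(k + 1))) := by
    ring
  rw [h3] at hk
  have h4 := lt_of_mul_lt_mul_left hk h2.le
  rw [Psi]
  nlinarith [mul_le_mul_of_nonneg_left hb1 hα₀.le,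
    mul_le_mul_of_nonneg_left hb2 (by linarith : 0 ≤ 1 - α)]

end Comparison

/-! ### The maximizers -/

section Maximizers

variable {W : Type*} [Fintype W] {n : ℕ} {α : ℝ}

lemma exists_iso_on_fin (D : SimpleGraph W) (hn : Fintype.card W = n) :
    ∃ T : SimpleGraph (Fin n), Nonempty (T ≃g D) :=
  ⟨D.comap (Fintype.equivFinOfCardEq hn).symm, ⟨SimpleGraph.Iso.comap _ D⟩⟩

lemma IsPsiMaximizer.le_Psi {T : SimpleGraph (Fin n)} (hT : IsPsiMaximizer T α)
    {D : SimpleGraph W} (hD : D.IsTree) (hn : Fintype.card W = n) (h2 : 2 ≤ n) :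
    Psi D α ≤ Psi T α := by
  obtain ⟨T₀, ⟨φ⟩⟩ := exists_iso_on_fin D hn
  rw [← Psi_eq_of_iso φ (by simpa using h2)]
  exact hT.2 T₀ (φ.isTree_iff.mpr hD)

/-- A tree which beats all trees not isomorphic to it is the unique maximizer. -/
lemma isPsiMaximizer_iff {D : SimpleGraph W} (hD : D.IsTree) (hn : Fintype.card W = n)
    (h2 : 2 ≤ n)
    (h : ∀ T : SimpleGraph (Fin n), T.IsTree → ¬Nonempty (T ≃g D) → Psi T α < Psi D α)
    (T : SimpleGraph (Fin n)) : IsPsiMaximizer T α ↔ Nonempty (T ≃g D) := by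
  have hiso : ∀ {T : SimpleGraph (Fin n)}, (T ≃g D) → Psi T α = Psi D α :=
    fun φ => Psi_eq_of_iso φ (by simpa using h2) α
  constructor
  · intro hT
    by_contra hne
    exact absurd (hT.le_Psi hD hn h2) (not_le.mpr (h T hT.1 hne))
  · rintro ⟨φ⟩
    refine ⟨φ.isTree_iff.mpr hD, fun T' hT' => ?_⟩
    rw [hiso φ]
    by_cases hne : Nonempty (T' ≃g D)
    · exact (hiso hne.some).le
    · exact (h T' hT' hne).le

lemma Psi_lt_Psi_DC_of_odd (hα₀ : 0 < α) (hα₁ : α ≤ 1 / 2) {k : ℕ} (hk : 3 ≤ k)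
    {T : SimpleGraph W} (hT : T.IsTree) (hcard : Fintype.card W = 2 * k + 3)
    (hne : ¬Nonempty (T ≃g DC k k 3)) : Psi T α < Psi (DC k k 3) α := by
  have hV : 2 ≤ Fintype.card W := by omega
  have hk' : (3 : ℝ) ≤ k := by exact_mod_cast hk
  obtain ⟨h1, h2⟩ := le_adjEigenvalue_DC_three k (by omega)
  have hD : α * √(k + 2) + (1 - α) * √k ≤ Psi (DC k k 3) α := by
    rw [Psi]
    nlinarith [mul_le_mul_of_nonneg_left h1 hα₀.le,
      mul_le_mul_of_nonneg_left h2 (by linarith : 0 ≤ 1 - α)]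
  by_contra! hle
  have hsum := hT.sq_adjEigenvalue_add_sq_le hV
  have hy : adjEigenvalue T 2 ≤ √k := by
    rcases le_or_gt (adjEigenvalue T 2) 0 with h0 | h0
    · exact h0.trans (Real.sqrt_nonneg _)
    · have h := hT.sq_adjEigenvalue_two_le hV h0
      rw [hcard, show (2 * k + 3) / 2 = k + 1 by omega] at h
      push_cast at h
      exact Real.le_sqrt_of_sq_le (by linarith)
  obtain ⟨e1, e2⟩ := eq_of_le_convexComb hα₀ hα₁ (Real.sqrt_pos.mpr (by linarith))
    (Real.sqrt_lt_sqrt (by linarith) (by linarith : (k : ℝ) < k + 2))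
    (by
      rw [Real.sq_sqrt (by linarith), Real.sq_sqrt (by linarith)]
      rw [hcard] at hsum
      push_cast at hsum
      linarith)
    hy (hD.trans hle)
  exact hne (hT.nonempty_iso_DC_of_odd hk hcard e1 e2)

lemma Psi_lt_Psi_DC_of_even (hα₀ : 0 < α) (hα₁ : α ≤ 1 / 2) {k : ℕ} (hk : 5 ≤ k)
    {T : SimpleGraph W} (hT : T.IsTree) (hcard : Fintype.card W = 2 * k + 4)
    (hne₄ : ¬Nonempty (T ≃g DC k k 4)) (hne₃ : ¬Nonempty (T ≃g DC k (k + 1) 3)) :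
    Psi T α < Psi (DC k (k + 1) 3) α := by
  have hV : 2 ≤ Fintype.card W := by omega
  have h5 : √(5 : ℝ) * √5 = 5 := Real.mul_self_sqrt (by norm_num)
  have h53 : √(5 : ℝ) < 3 := by nlinarith [Real.sqrt_nonneg (5 : ℝ)]
  have h50 : 0 < √(5 : ℝ) := Real.sqrt_pos.mpr (by norm_num)
  have hk' : (0 : ℝ) ≤ k := by positivity
  have hlt : adjEigenvalue T 2 < √(k + (3 - √5) / 2) := by
    by_contra! hle
    exact (hT.nonempty_iso_DC_of_even hk hcard hle).elim hne₄ hne₃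
  have hsum := hT.sq_adjEigenvalue_add_sq_le hV
  rw [Psi, Psi, (adjEigenvalue_DC_three_succ k).1, (adjEigenvalue_DC_three_succ k).2]
  refine convexComb_lt hα₀ hα₁ (Real.sqrt_pos.mpr (by linarith))
    (Real.sqrt_lt_sqrt (by linarith) (by linarith)) ?_ hlt
  rw [Real.sq_sqrt (by linarith), Real.sq_sqrt (by linarith)]
  rw [hcard] at hsum
  push_cast at hsum
  linarith

end Maximizers

theorem theorem1p4 (α : ℝ) (hα₀ : 0 < α) (hα₁ : α ≤ 1 / 2) :
    ∃ N : ℕ, ∀ n : ℕ, N ≤ n →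
      (Odd n → ∀ T : SimpleGraph (Fin n),
        IsPsiMaximizer T α ↔ Nonempty (T ≃g DC ((n - 3) / 2) ((n - 3) / 2) 3)) ∧
      (Even n →
        (∀ T : SimpleGraph (Fin n), IsPsiMaximizer T α →
          Nonempty (T ≃g DC ((n - 4) / 2) ((n - 4) / 2) 4) ∨
          Nonempty (T ≃g DC ((n - 4) / 2) ((n - 2) / 2) 3)) ∧
        (α < (√5 - 1) / (2 * √5) → ∀ T : SimpleGraph (Fin n),
          IsPsiMaximizer T α ↔ Nonempty (T ≃g DC ((n - 4) / 2) ((n - 4) / 2) 4)) ∧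
        ((√5 - 1) / (2 * √5) < α → ∀ T : SimpleGraph (Fin n),
          IsPsiMaximizer T α ↔ Nonempty (T ≃g DC ((n - 4) / 2) ((n - 2) / 2) 3))) := by
  obtain ⟨K, hK⟩ : ∃ K : ℕ, ∀ k ≥ K, 5 ≤ k ∧
      (α < (√5 - 1) / (2 * √5) → Psi (DC k (k + 1) 3) α < Psi (DC k k 4) α) ∧
      ((√5 - 1) / (2 * √5) < α → Psi (DC k k 4) α < Psi (DC k (k + 1) 3) α) := by
    rw [← Filter.eventually_atTop]
    refine (Filter.eventually_ge_atTop 5).and (.and ?_ ?_)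
    · by_cases h : α < (√5 - 1) / (2 * √5)
      · exact (eventually_Psi_DC_three_succ_lt hα₀ h).mono fun _ hk _ => hk
      · exact .of_forall fun _ h' => absurd h' h
    · by_cases h : (√5 - 1) / (2 * √5) < α
      · exact (eventually_Psi_DC_four_lt hα₀ hα₁ h).mono fun _ hk _ => hk
      · exact .of_forall fun _ h' => absurd h' h
  refine ⟨2 * K + 13, fun n hn => ⟨?_, ?_⟩⟩
  · rintro ⟨m, rfl⟩
    obtain ⟨k, rfl⟩ : ∃ k, m = k + 1 := ⟨m - 1, by omega⟩
    rw [show (2 * (k + 1) + 1 - 3) / 2 = k by omega]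
    exact isPsiMaximizer_iff (DC_isTree (by norm_num)) (by rw [DCVertex.card]; ring) (by omega)
      fun T hT hne => Psi_lt_Psi_DC_of_odd hα₀ hα₁ (by omega) hT (by simp; ring) hne
  · rintro ⟨m, rfl⟩
    obtain ⟨k, rfl⟩ : ∃ k, m = k + 2 := ⟨m - 2, by omega⟩
    rw [show (k + 2 + (k + 2) - 4) / 2 = k by omega,
      show (k + 2 + (k + 2) - 2) / 2 = k + 1 by omega]
    obtain ⟨hk, hlt, hgt⟩ := hK k (by omega)
    have hn2 : 2 ≤ k + 2 + (k + 2) := by omega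
    have hfin : Fintype.card (Fin (k + 2 + (k + 2))) = 2 * k + 4 := by simp; ring
    have hc₃ : Fintype.card (DCVertex k (k + 1) 3) = k + 2 + (k + 2) := by rw [DCVertex.card]; ring
    have hc₄ : Fintype.card (DCVertex k k 4) = k + 2 + (k + 2) := by rw [DCVertex.card]; ring
    have ht₃ : (DC k (k + 1) 3).IsTree := DC_isTree (by norm_num)
    have ht₄ : (DC k k 4).IsTree := DC_isTree (by norm_num)
    have hiso : ∀ {T : SimpleGraph (Fin (k + 2 + (k + 2)))} {l r ℓ : ℕ}, (T ≃g DC l r ℓ) →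
        Psi T α = Psi (DC l r ℓ) α := fun φ => Psi_eq_of_iso φ (by simpa using hn2) α
    have hother : ∀ T : SimpleGraph (Fin (k + 2 + (k + 2))), T.IsTree →
        ¬Nonempty (T ≃g DC k k 4) → ¬Nonempty (T ≃g DC k (k + 1) 3) →
        Psi T α < Psi (DC k (k + 1) 3) α :=
      fun T hT h₄ h₃ => Psi_lt_Psi_DC_of_even hα₀ hα₁ hk hT hfin h₄ h₃
    refine ⟨fun T hT => ?_, fun hα => ?_, fun hα => ?_⟩
    · by_contra! h
      rw [← not_nonempty_iff, ← not_nonempty_iff] at h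
      exact absurd (hT.le_Psi ht₃ hc₃ hn2) (not_le.mpr (hother T hT.1 h.1 h.2))
    · refine isPsiMaximizer_iff ht₄ hc₄ hn2 fun T hT h₄ => ?_
      by_cases h₃ : Nonempty (T ≃g DC k (k + 1) 3)
      · rw [hiso h₃.some]
        exact hlt hα
      · exact (hother T hT h₄ h₃).trans (hlt hα)
    · refine isPsiMaximizer_iff ht₃ hc₃ hn2 fun T hT h₃ => ?_
      by_cases h₄ : Nonempty (T ≃g DC k k 4)
      · rw [hiso h₄.some]
        exact hgt hα
      · exact hother T hT h₄ h₃
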